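/- All directed graphs are finite and may have parallel edges. For a vertex $v$ of a directed graph, $I(v)$ and $O(v)$ denote its sets of incoming and outgoing edges; $v$ is a source if $I(v)=\emptyset$ and a sink if $O(v)=\emptyset$. For a directed graph $H$, $V(H)$, $E(H)$, $S(H)$, $T(H)$ denote its sets of vertices, edges, sources and sinks; $I(H)$ (resp. $O(H)$) is the set of edges of $H$ that start at a source (resp. end at a sink); $s(e)$ and $t(e)$ are the starting and the end vertex of an edge $e$. An upward planar graph is a crossing-free drawing in $\mathbb{R}^2$ of an acyclic directed graph in which every edge $e$ is a continuous curve from $s(e)$ to $t(e)$ whose vertical coordinate increases strictly. A progressive plane graph is an upward planar graph in which every source and every sink has degree one, and which is contained in a box $[a,b]\times[c,d]$ with $a<b$, $c<d$, such that all sources lie on the bottom side $y=c$ and all sinks on the top side $y=d$. (With the opposite vertical convention everything is reflected in a horizontal line.) In such a drawing $O(v)$ and $I(v)$ are linearly ordered from left to right, by the position of the edges just above, respectively just below, $v$; this is the polarization. For a nonempty finite linearly ordered set $X$ write $X^-=\min X$ and $X^+=\max X$. Proposition. Let $G$ be an upward planar graph. Then there exist a progressive plane graph $\Gamma$ and an embedding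 $\phi=(\phi_0,\phi_1)\colon G\to\Gamma$ (that is, injective maps $\phi_0\colon V(G)\to V(\Gamma)$ and $\phi_1\colon E(G)\to E(\Gamma)$ compatible with $s$ and $t$, such that the drawing of $\Gamma$ restricted to $\phi(G)$ is the drawing of $G$) such that (1) $\phi_0(V(G))=V(\Gamma)\setminus(S(\Gamma)\cup T(\Gamma))$; (2) $|E(\Gamma)|=|E(G)|+|S(G)|+|T(G)|$; (3) $I(\phi_0(v))\cap O(\phi_0(w))=\emptyset$ for all $v\in S(G)$ and $w\in T(G)$; (4) for every $e\in E(\Gamma)\setminus(\phi_1(E(G))\cup I(\Gamma)\cup O(\Gamma))$, either $O(s(e))^-<e<O(s(e))^+$ or $I(t(e))^-<e<I(t(e))^+$, where the linear orders are given by the polarization of $\Gamma$. -/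

import Mathlib

universe u v

/-- A directed graph with vertex set `V` and edge set `E`; parallel edges are allowed. -/
structure DirGraph (V : Type u) (E : Type v) where
  src : E → V
  tgt : E → V

namespace DirGraph

variable {V : Type*} {E : Type*} {W : Type*} {F : Type*}

/-- `I(x)`: the incoming edges of `x`. -/
def inEdges (G : DirGraph V E) (x : V) : Set E := {e | G.tgt e = x}

/-- `O(x)`: the outgoing edges of `x`. -/
def outEdges (G : DirGraph V E) (x : V) : Set E := {e | G.src e = x}

/-- `S(G)`: the vertices without incoming edges. -/
def sources (G : DirGraph V E) : Set V := {x | G.inEdges x = ∅}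

/-- `T(G)`: the vertices without outgoing edges. -/
def sinks (G : DirGraph V E) : Set V := {x | G.outEdges x = ∅}

/-- There is no directed cycle (in particular no loop). -/
def Acyclic (G : DirGraph V E) : Prop :=
  ∀ x : V, ¬ Relation.TransGen (fun a b => ∃ e, G.src e = a ∧ G.tgt e = b) x x

/-- The degree of a vertex (meant for finite graphs). -/
noncomputable def degree (G : DirGraph V E) (x : V) : ℕ :=
  (G.inEdges x).ncard + (G.outEdges x).ncard

/-- A progressive graph: acyclic, and all sources and sinks have degree one. -/
structure IsProgressive (G : DirGraph V E) : Prop where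
  acyclic : G.Acyclic
  degree_source : ∀ x ∈ G.sources, G.degree x = 1
  degree_sink : ∀ x ∈ G.sinks, G.degree x = 1

/-- `I(G)`: the edges that start from a source. -/
def inputEdges (G : DirGraph V E) : Set E := {e | G.src e ∈ G.sources}

/-- `O(G)`: the edges that end in a sink. -/
def outputEdges (G : DirGraph V E) : Set E := {e | G.tgt e ∈ G.sinks}

/-- An embedding of directed graphs: injective on vertices and on edges, compatible with the
endpoints. -/
structure Embedding (G : DirGraph V E) (H : DirGraph W F) where
  onVert : V ↪ W
  onEdge : E ↪ F
  src_onEdge : ∀ e, H.src (onEdge e) = onVert (G.src e)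
  tgt_onEdge : ∀ e, H.tgt (onEdge e) = onVert (G.tgt e)

/-- A planar embedding (drawing without crossings) of `G`: vertices are distinct points of the
plane, an edge is a simple curve from its source to its target, the open edges avoid all vertices
and are pairwise disjoint. -/
structure PlanarEmbedding (G : DirGraph V E) where
  pos : V → ℝ × ℝ
  curve : E → unitInterval → ℝ × ℝ
  pos_injective : Function.Injective pos
  continuous_curve : ∀ e, Continuous (curve e)
  curve_zero : ∀ e, curve e 0 = pos (G.src e)
  curve_one : ∀ e, curve e 1 = pos (G.tgt e)
  injOn_curve : ∀ e, Set.InjOn (curve e) (Set.Ioo 0 1)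
  curve_ne_pos : ∀ e, ∀ t ∈ Set.Ioo (0 : unitInterval) 1, ∀ x, curve e t ≠ pos x
  curve_ne_curve : ∀ e e', e ≠ e' → ∀ t ∈ Set.Ioo (0 : unitInterval) 1,
    ∀ t' ∈ Set.Ioo (0 : unitInterval) 1, curve e t ≠ curve e' t'

namespace PlanarEmbedding

variable {G : DirGraph V E}

/-- All edges increase strictly monotonically in the vertical direction. -/
def IsUpward (D : G.PlanarEmbedding) : Prop :=
  ∀ e, StrictMono fun t => (D.curve e t).2

/-- The drawing lies in a plane box `[a, b] × [c, d]`, with all sources on one horizontal side and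
all sinks on the other. As edges are drawn upward here, the sources are at the bottom. -/
def IsBoxed (D : G.PlanarEmbedding) : Prop :=
  ∃ a b c d : ℝ, a < b ∧ c < d ∧
    (∀ x, D.pos x ∈ Set.Icc a b ×ˢ Set.Icc c d) ∧
    (∀ e t, D.curve e t ∈ Set.Icc a b ×ˢ Set.Icc c d) ∧
    (∀ x ∈ G.sources, (D.pos x).2 = c) ∧
    (∀ x ∈ G.sinks, (D.pos x).2 = d)

/-- The order of the polarization on `O(x)`, for an upward drawing: `e` precedes `e'` if, just above
`x`, the edge `e` runs to the left of `e'`. -/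
def outLt (D : G.PlanarEmbedding) (x : V) (e e' : E) : Prop :=
  e ∈ G.outEdges x ∧ e' ∈ G.outEdges x ∧
    ∃ δ : ℝ, 0 < δ ∧ ∀ t t', (D.curve e t).2 = (D.curve e' t').2 →
      (D.curve e t).2 ∈ Set.Ioo (D.pos x).2 ((D.pos x).2 + δ) →
      (D.curve e t).1 < (D.curve e' t').1

/-- The order of the polarization on `I(x)`, for an upward drawing: `e` precedes `e'` if, just below
`x`, the edge `e` runs to the left of `e'`. -/
def inLt (D : G.PlanarEmbedding) (x : V) (e e' : E) : Prop :=
  e ∈ G.inEdges x ∧ e' ∈ G.inEdges x ∧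
    ∃ δ : ℝ, 0 < δ ∧ ∀ t t', (D.curve e t).2 = (D.curve e' t').2 →
      (D.curve e t).2 ∈ Set.Ioo ((D.pos x).2 - δ) (D.pos x).2 →
      (D.curve e t).1 < (D.curve e' t').1

end PlanarEmbedding

end DirGraph

/-- `X⁻ < e < X⁺`, where `X⁻` and `X⁺` are the least and the greatest element of `X` for the strict
order `lt`. -/
def StrictlyInside {E : Type*} (lt : E → E → Prop) (X : Set E) (e : E) : Prop :=
  ∃ m M, (m ∈ X ∧ ∀ f ∈ X, f ≠ m → lt m f) ∧ (M ∈ X ∧ ∀ f ∈ X, f ≠ M → lt f M) ∧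
    lt m e ∧ lt e M

/-- An upward planar graph: an upward planar embedding of an acyclic directed graph. -/
structure UpwardPlanarGraph (V : Type u) (E : Type v) where
  graph : DirGraph V E
  acyclic : graph.Acyclic
  drawing : graph.PlanarEmbedding
  upward : drawing.IsUpward

/-- A progressive plane graph: a boxed and upward planar embedding of a progressive graph. -/
structure ProgressivePlaneGraph (V : Type u) (E : Type v) where
  graph : DirGraph V E
  progressive : graph.IsProgressive
  drawing : graph.PlanarEmbedding
  upward : drawing.IsUpward
  boxed : drawing.IsBoxed

/-!
Draw a path downwards from a source `v`, staying strictly between the edges to its left and to its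
right. In a horizontal strip without vertices this is possible until the height of a vertex is
reached. There either the left and the right edges are still apart, and the path crosses that height
at a point outside the drawing, or a left and a right edge meet at a vertex `w`, and the path ends
at `w` between two outgoing edges of `w`. As there are finitely many vertices, the path ends at such
a vertex or on the bottom line. Treating the sources one after another and then, by reflection, the
sinks yields the progressive plane graph. A new edge never leaves a vertex with at most one outgoing
edge, so after the first half the sinks are the original ones; dually, in the second half no edge is
attached to a source of `G`, which has exactly one incoming edge by then.
-/

open Set Filter Topology

/-! ### Continuous functions and finite orders -/

theorem exists_continuous_mem_Ioo {L U : ℝ → ℝ} (hL : Continuous L) (hU : Continuous U)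
    {p q x' x : ℝ} (hpq : p < q) (hLU : ∀ y ∈ Ioo p q, L y < U y) (hx' : x' ∈ Icc (L p) (U p))
    (hx : x ∈ Ioo (L q) (U q)) :
    ∃ g : ℝ → ℝ, Continuous g ∧ g p = x' ∧ g q = x ∧ ∀ y ∈ Ioo p q, g y ∈ Ioo (L y) (U y) := by
  have hq : 0 < U q - L q := sub_pos.2 (hx.1.trans hx.2)
  -- The relative position between `L` and `U` moves linearly. If `L p = U p` then `s = 0`.
  set s := (x' - L p) / (U p - L p)
  set t := (x - L q) / (U q - L q)
  have hs0 : 0 ≤ s := div_nonneg (sub_nonneg.2 hx'.1) (sub_nonneg.2 (hx'.1.trans hx'.2))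
  have hs1 : s ≤ 1 := div_le_one_of_le₀ (sub_le_sub_right hx'.2 _)
    (sub_nonneg.2 (hx'.1.trans hx'.2))
  have ht0 : 0 < t := div_pos (sub_pos.2 hx.1) hq
  have ht1 : t < 1 := (div_lt_one hq).2 (sub_lt_sub_right hx.2 _)
  have hsx' : s * (U p - L p) = x' - L p := by
    refine div_mul_cancel_of_imp fun h => ?_
    linarith [hx'.1, hx'.2]
  have htx : t * (U q - L q) = x - L q := div_mul_cancel₀ _ hq.ne'
  refine ⟨fun y => AffineMap.lineMap (L y) (U y) (AffineMap.lineMap s t ((y - p) / (q - p))),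
    by simp only [AffineMap.lineMap_apply]; fun_prop, ?_, ?_, fun y hy => ?_⟩
  · simp [AffineMap.lineMap_apply, hsx']
  · simp [AffineMap.lineMap_apply, div_self (sub_pos.2 hpq).ne', htx]
  · have hr0 : 0 < (y - p) / (q - p) := div_pos (sub_pos.2 hy.1) (sub_pos.2 hpq)
    have hr1 : (y - p) / (q - p) < 1 := (div_lt_one (sub_pos.2 hpq)).2 (sub_lt_sub_right hy.2 _)
    set r := (y - p) / (q - p)
    have hθ0 : 0 < AffineMap.lineMap s t r := by
      simp only [AffineMap.lineMap_apply_ring]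
      nlinarith [mul_pos hr0 ht0]
    have hθ1 : AffineMap.lineMap s t r < 1 := by
      simp only [AffineMap.lineMap_apply_ring]
      nlinarith [mul_pos hr0 (sub_pos.2 ht1)]
    exact ⟨(left_lt_lineMap_iff_lt hθ0).2 (hLU y hy), (lineMap_lt_right_iff_lt hθ1).2 (hLU y hy)⟩

theorem continuous_finset_fold {ι X α : Type*} [TopologicalSpace X] [TopologicalSpace α]
    {op : α → α → α} [Std.Commutative op] [Std.Associative op]
    (hop : Continuous (Function.uncurry op)) {k : X → α} (hk : Continuous k) {f : ι → X → α}
    (hf : ∀ i, Continuous (f i)) (A : Finset ι) : Continuous fun x => A.fold op (k x) (f · x) := by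
  classical
  induction A using Finset.induction_on with
  | empty => exact hk
  | insert i A hi ih =>
    simp only [Finset.fold_insert hi]
    exact hop.comp ((hf i).prodMk ih)

theorem exists_continuous_between_finset {ι : Type*} (A B : Finset ι) {f : ι → ℝ → ℝ}
    (hf : ∀ i, Continuous (f i)) {p q x' x : ℝ} (hpq : p < q)
    (hAB : ∀ a ∈ A, ∀ b ∈ B, ∀ y ∈ Ioo p q, f a y < f b y)
    (hA' : ∀ a ∈ A, f a p ≤ x') (hB' : ∀ b ∈ B, x' ≤ f b p)
    (hA : ∀ a ∈ A, f a q < x) (hB : ∀ b ∈ B, x < f b q) :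
    ∃ g : ℝ → ℝ, Continuous g ∧ g p = x' ∧ g q = x ∧
      ∀ y ∈ Ioo p q, (∀ a ∈ A, f a y < g y) ∧ ∀ b ∈ B, g y < f b y := by
  -- `m` and `M` replace the missing bounds if `A` or `B` is empty.
  let m y := B.fold min (min x x') (f · y) - 1
  let M y := A.fold max (max x x') (f · y) + 1
  let L y := A.fold max (m y) (f · y)
  let U y := B.fold min (M y) (f · y)
  have hL : Continuous L := continuous_finset_fold continuous_max
    ((continuous_finset_fold continuous_min continuous_const hf B).sub continuous_const) hf A
  have hU : Continuous U := continuous_finset_fold continuous_min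
    ((continuous_finset_fold continuous_max continuous_const hf A).add continuous_const) hf B
  have hm : ∀ y, m y < min x x' ∧ ∀ b ∈ B, m y < f b y := fun y => by
    rw [← Finset.lt_fold_min]; exact sub_one_lt _
  have hM : ∀ y, max x x' < M y ∧ ∀ a ∈ A, f a y < M y := fun y => by
    rw [← Finset.fold_max_lt]; exact lt_add_one _
  have hm' := fun y => lt_min_iff.1 (hm y).1
  have hM' := fun y => max_lt_iff.1 (hM y).1
  have hLU : ∀ y ∈ Ioo p q, L y < U y := fun y hy => by
    refine (Finset.fold_max_lt _).2 ⟨(Finset.lt_fold_min _).2 ⟨?_, (hm y).2⟩, fun a ha =>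
      (Finset.lt_fold_min _).2 ⟨(hM y).2 a ha, fun b hb => hAB a ha b hb y hy⟩⟩
    exact (hm' y).1.trans (hM' y).1
  have hx' : x' ∈ Icc (L p) (U p) := ⟨(Finset.fold_max_le _).2 ⟨(hm' p).2.le, hA'⟩,
    (Finset.le_fold_min _).2 ⟨(hM' p).2.le, hB'⟩⟩
  have hx : x ∈ Ioo (L q) (U q) := ⟨(Finset.fold_max_lt _).2 ⟨(hm' q).1, hA⟩,
    (Finset.lt_fold_min _).2 ⟨(hM' q).1, hB⟩⟩
  obtain ⟨g, hg, hgp, hgq, hgLU⟩ := exists_continuous_mem_Ioo hL hU hpq hLU hx' hx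
  refine ⟨g, hg, hgp, hgq, fun y hy => ⟨fun a ha => ?_, fun b hb => ?_⟩⟩
  · exact ((Finset.le_fold_max _).2 (.inr ⟨a, ha, le_rfl⟩)).trans_lt (hgLU y hy).1
  · exact (hgLU y hy).2.trans_le ((Finset.fold_min_le _).2 (.inr ⟨b, hb, le_rfl⟩))

theorem exists_between_finset_notMem {α : Type*} [LinearOrder α] [DenselyOrdered α] [NoMaxOrder α]
    [NoMinOrder α] [Nonempty α] (A B C : Finset α) (h : ∀ a ∈ A, ∀ b ∈ B, a < b) :
    ∃ m, (∀ a ∈ A, a < m) ∧ (∀ b ∈ B, m < b) ∧ m ∉ C := by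
  obtain ⟨m₀, hA, hB⟩ := A.exists_between' B h
  obtain ⟨m, hm, hBC⟩ := Finset.exists_between' {m₀} (B ∪ {c ∈ C | m₀ < c}) (by
    simp only [Finset.mem_singleton, Finset.mem_union, Finset.mem_filter]
    rintro _ rfl b (hb | hb)
    exacts [hB b hb, hb.2])
  simp only [Finset.mem_singleton, forall_eq, Finset.mem_union, Finset.mem_filter] at hm hBC
  exact ⟨m, fun a ha => (hA a ha).trans hm, fun b hb => hBC b (.inl hb),
    fun hmC => lt_irrefl _ (hBC m (.inr ⟨hmC, hm⟩))⟩

theorem strictlyInside_of_lt_of_lt {E : Type*} [Finite E] {lt : E → E → Prop} [IsStrictOrder E lt]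
    {X : Set E} (trichotomous : ∀ e ∈ X, ∀ f ∈ X, lt e f ∨ e = f ∨ lt f e) {m e M : E}
    (hm : m ∈ X) (hM : M ∈ X) (hme : lt m e) (heM : lt e M) : StrictlyInside lt X e := by
  obtain ⟨m₀, hm₀, hmin⟩ := (Finite.wellFounded_of_trans_of_irrefl lt).has_min X ⟨m, hm⟩
  obtain ⟨M₀, hM₀, hmax⟩ := (Finite.wellFounded_of_trans_of_irrefl (Function.swap lt)).has_min X
    ⟨M, hM⟩
  have hleast : ∀ f ∈ X, f ≠ m₀ → lt m₀ f := fun f hf hne =>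
    ((trichotomous m₀ hm₀ f hf).resolve_right fun h => h.elim (hne ·.symm) (hmin f hf))
  have hgreatest : ∀ f ∈ X, f ≠ M₀ → lt f M₀ := fun f hf hne =>
    ((trichotomous f hf M₀ hM₀).resolve_right fun h => h.elim hne (hmax f hf))
  refine ⟨m₀, M₀, ⟨hm₀, hleast⟩, ⟨hM₀, hgreatest⟩, ?_, ?_⟩
  · obtain rfl | hne := eq_or_ne m m₀
    exacts [hme, _root_.trans (hleast m hm hne) hme]
  · obtain rfl | hne := eq_or_ne M M₀
    exacts [heM, _root_.trans heM (hgreatest M hM hne)]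

/-! ### Upward drawings -/

namespace DirGraph

variable {V E : Type*} {G : DirGraph V E}

theorem mem_sources {x : V} : x ∈ G.sources ↔ ∀ e, G.tgt e ≠ x := eq_empty_iff_forall_notMem

theorem mem_sinks {x : V} : x ∈ G.sinks ↔ ∀ e, G.src e ≠ x := eq_empty_iff_forall_notMem

namespace PlanarEmbedding

/-- The height at which the edge `e` starts. -/
def bottom (D : G.PlanarEmbedding) (e : E) : ℝ := (D.pos (G.src e)).2

/-- The height at which the edge `e` ends. -/
def top (D : G.PlanarEmbedding) (e : E) : ℝ := (D.pos (G.tgt e)).2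

variable {D : G.PlanarEmbedding}

theorem bottom_eq {x : V} {e : E} (he : e ∈ G.outEdges x) : D.bottom e = (D.pos x).2 := by
  rw [bottom, he.out]

theorem snd_curve_zero (D : G.PlanarEmbedding) (e : E) : (D.curve e 0).2 = D.bottom e :=
  congrArg Prod.snd (D.curve_zero e)

theorem snd_curve_one (D : G.PlanarEmbedding) (e : E) : (D.curve e 1).2 = D.top e :=
  congrArg Prod.snd (D.curve_one e)

theorem outLt_of_eventually_lt {x : V} {e e' : E} (he : e ∈ G.outEdges x) (he' : e' ∈ G.outEdges x)
    {f f' : ℝ → ℝ} (hf : ∀ t, (D.curve e t).1 = f (D.curve e t).2)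
    (hf' : ∀ t, (D.curve e' t).1 = f' (D.curve e' t).2)
    (hlt : ∀ᶠ y in 𝓝[>] (D.pos x).2, f y < f' y) : D.outLt x e e' := by
  obtain ⟨z, hz, hsub⟩ := mem_nhdsGT_iff_exists_Ioo_subset.1 hlt
  refine ⟨he, he', z - (D.pos x).2, sub_pos.2 hz, fun t t' htt' ht => ?_⟩
  rw [add_sub_cancel] at ht
  rw [hf, hf', ← htt']
  exact hsub ht

namespace IsUpward

theorem bottom_lt_top (hD : D.IsUpward) (e : E) : D.bottom e < D.top e := by
  rw [← D.snd_curve_zero, ← D.snd_curve_one]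
  exact hD e zero_lt_one

theorem snd_curve_mem_Icc (hD : D.IsUpward) (e : E) (t : unitInterval) :
    (D.curve e t).2 ∈ Icc (D.bottom e) (D.top e) := by
  rw [← D.snd_curve_zero, ← D.snd_curve_one]
  exact ⟨(hD e).monotone unitInterval.nonneg', (hD e).monotone unitInterval.le_one'⟩

theorem acyclic (hD : D.IsUpward) : G.Acyclic := by
  have height_lt : ∀ x y, Relation.TransGen (fun a b => ∃ e, G.src e = a ∧ G.tgt e = b) x y →
      (D.pos x).2 < (D.pos y).2 := by
    intro x y hxy
    induction hxy with
    | single h =>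
      obtain ⟨e, rfl, rfl⟩ := h
      exact hD.bottom_lt_top e
    | tail _ h ih =>
      obtain ⟨e, rfl, rfl⟩ := h
      exact ih.trans (hD.bottom_lt_top e)
  exact fun x hx => lt_irrefl _ (height_lt x x hx)

theorem exists_xAt (hD : D.IsUpward) (e : E) :
    ∃ f : ℝ → ℝ, Continuous f ∧ ∀ t, (D.curve e t).1 = f (D.curve e t).2 := by
  have hc : Continuous fun t => (D.curve e t).2 := continuous_snd.comp (D.continuous_curve e)
  obtain ⟨f, hf⟩ := ContinuousMap.exists_extension' (hc.isClosedEmbedding (hD e).injective)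
    (⟨fun t => (D.curve e t).1, continuous_fst.comp (D.continuous_curve e)⟩ : C(unitInterval, ℝ))
  exact ⟨f, f.continuous, fun t => (congrFun hf t).symm⟩

/-- The horizontal coordinate of the edge `e` of an upward drawing as a continuous function of the
height. Outside `[D.bottom e, D.top e]` its values are arbitrary. -/
noncomputable def xAt (hD : D.IsUpward) (e : E) : ℝ → ℝ := (hD.exists_xAt e).choose

theorem continuous_xAt (hD : D.IsUpward) (e : E) : Continuous (hD.xAt e) :=
  (hD.exists_xAt e).choose_spec.1

theorem fst_curve (hD : D.IsUpward) (e : E) (t : unitInterval) :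
    (D.curve e t).1 = hD.xAt e (D.curve e t).2 :=
  (hD.exists_xAt e).choose_spec.2 t

theorem exists_curve_eq (hD : D.IsUpward) {e : E} {y : ℝ} (hy : y ∈ Icc (D.bottom e) (D.top e)) :
    ∃ t, D.curve e t = (hD.xAt e y, y) := by
  have hc : Continuous fun t => (D.curve e t).2 := continuous_snd.comp (D.continuous_curve e)
  rw [← D.snd_curve_zero, ← D.snd_curve_one] at hy
  obtain ⟨t, rfl⟩ := intermediate_value_univ (0 : unitInterval) 1 hc hy
  exact ⟨t, Prod.ext (hD.fst_curve e t) rfl⟩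

theorem exists_mem_Ioo_curve_eq (hD : D.IsUpward) {e : E} {y : ℝ}
    (hy : y ∈ Ioo (D.bottom e) (D.top e)) :
    ∃ t ∈ Ioo (0 : unitInterval) 1, D.curve e t = (hD.xAt e y, y) := by
  obtain ⟨t, ht⟩ := hD.exists_curve_eq (Ioo_subset_Icc_self hy)
  have hty : (D.curve e t).2 = y := congrArg Prod.snd ht
  rw [← hty, ← D.snd_curve_zero, ← D.snd_curve_one] at hy
  exact ⟨t, ⟨(hD e).lt_iff_lt.1 hy.1, (hD e).lt_iff_lt.1 hy.2⟩, ht⟩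

theorem pos_src (hD : D.IsUpward) (e : E) :
    D.pos (G.src e) = (hD.xAt e (D.bottom e), D.bottom e) := by
  rw [← D.curve_zero, ← D.snd_curve_zero, ← hD.fst_curve]

theorem xAt_ne_pos (hD : D.IsUpward) {e : E} {y : ℝ} (hy : y ∈ Ioo (D.bottom e) (D.top e))
    (x : V) : D.pos x ≠ (hD.xAt e y, y) := by
  obtain ⟨t, ht, h⟩ := hD.exists_mem_Ioo_curve_eq hy
  exact h ▸ (D.curve_ne_pos e t ht x).symm

theorem xAt_ne_xAt (hD : D.IsUpward) {e e' : E} (hne : e ≠ e') {y : ℝ}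
    (hy : y ∈ Ioo (D.bottom e) (D.top e)) (hy' : y ∈ Ioo (D.bottom e') (D.top e')) :
    hD.xAt e y ≠ hD.xAt e' y := by
  intro h
  obtain ⟨t, ht, he⟩ := hD.exists_mem_Ioo_curve_eq hy
  obtain ⟨t', ht', he'⟩ := hD.exists_mem_Ioo_curve_eq hy'
  exact D.curve_ne_curve e e' hne t ht t' ht' (by rw [he, he', h])

theorem pos_src_eq_of_xAt_eq (hD : D.IsUpward) {e e' : E} (hne : e ≠ e') {y : ℝ}
    (hy : y ∈ Ico (D.bottom e) (D.top e)) (hy' : y ∈ Ico (D.bottom e') (D.top e'))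
    (h : hD.xAt e y = hD.xAt e' y) : D.pos (G.src e) = (hD.xAt e y, y) := by
  obtain heq | hlt := hy.1.eq_or_lt
  · rw [hD.pos_src, heq]
  obtain heq' | hlt' := hy'.1.eq_or_lt
  · exact absurd (by rw [hD.pos_src, heq', h]) (hD.xAt_ne_pos ⟨hlt, hy.2⟩ (G.src e'))
  · exact absurd h (hD.xAt_ne_xAt hne ⟨hlt, hy.2⟩ ⟨hlt', hy'.2⟩)

theorem src_eq_src_of_xAt_eq (hD : D.IsUpward) {e e' : E} {y : ℝ}
    (hy : y ∈ Ico (D.bottom e) (D.top e)) (hy' : y ∈ Ico (D.bottom e') (D.top e'))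
    (h : hD.xAt e y = hD.xAt e' y) : G.src e = G.src e' := by
  obtain rfl | hne := eq_or_ne e e'
  · rfl
  · apply D.pos_injective
    rw [hD.pos_src_eq_of_xAt_eq hne hy hy' h, hD.pos_src_eq_of_xAt_eq hne.symm hy' hy h.symm, h]

theorem xAt_lt_xAt_of_le (hD : D.IsUpward) {e e' : E} {y z : ℝ} (hyz : y ≤ z)
    (hz : hD.xAt e z < hD.xAt e' z) (hy : D.bottom e < y) (hy' : D.bottom e' < y)
    (hze : z ≤ D.top e) (hze' : z ≤ D.top e') : hD.xAt e y < hD.xAt e' y := by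
  by_contra! hle
  obtain ⟨u, hu, heq⟩ := isPreconnected_Icc.intermediate_value₂ (right_mem_Icc.2 hyz)
    (left_mem_Icc.2 hyz) (hD.continuous_xAt e).continuousOn
    (hD.continuous_xAt e').continuousOn hz.le hle
  obtain rfl | huz := hu.2.eq_or_lt
  · exact hz.ne heq
  · exact hD.xAt_ne_xAt (by rintro rfl; exact hz.false) ⟨hy.trans_le hu.1, huz.trans_le hze⟩
      ⟨hy'.trans_le hu.1, huz.trans_le hze'⟩ heq

theorem outLt_of_xAt_lt (hD : D.IsUpward) {x : V} {e e' : E} (he : e ∈ G.outEdges x)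
    (he' : e' ∈ G.outEdges x) {y : ℝ} (hxy : (D.pos x).2 < y) (hy : y ≤ D.top e)
    (hy' : y ≤ D.top e') (hlt : hD.xAt e y < hD.xAt e' y) : D.outLt x e e' := by
  refine outLt_of_eventually_lt he he' (hD.fst_curve e) (hD.fst_curve e') ?_
  filter_upwards [Ioo_mem_nhdsGT hxy] with z hz
  exact hD.xAt_lt_xAt_of_le hz.2.le hlt (bottom_eq he ▸ hz.1) (bottom_eq he' ▸ hz.1) hy hy'

theorem eventually_xAt_lt (hD : D.IsUpward) {x : V} {e e' : E} (h : D.outLt x e e') :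
    ∀ᶠ y in 𝓝[>] (D.pos x).2, hD.xAt e y < hD.xAt e' y := by
  obtain ⟨he, he', δ, hδ, hlt⟩ := h
  filter_upwards [Ioo_mem_nhdsGT (lt_add_of_pos_right (D.pos x).2 hδ),
    Ioo_mem_nhdsGT (bottom_eq he ▸ hD.bottom_lt_top e),
    Ioo_mem_nhdsGT (bottom_eq he' ▸ hD.bottom_lt_top e')] with y hy hye hye'
  rw [← bottom_eq he] at hye
  rw [← bottom_eq he'] at hye'
  obtain ⟨t, ht⟩ := hD.exists_curve_eq (Ioo_subset_Icc_self hye)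
  obtain ⟨t', ht'⟩ := hD.exists_curve_eq (Ioo_subset_Icc_self hye')
  simpa only [ht, ht', hy, forall_const] using hlt t t'

theorem isStrictOrder_outLt (hD : D.IsUpward) (x : V) : IsStrictOrder E (D.outLt x) where
  irrefl e h := by
    obtain ⟨y, hy⟩ := (hD.eventually_xAt_lt h).exists
    exact hy.false
  trans e₁ e₂ e₃ h h' := by
    refine outLt_of_eventually_lt h.1 h'.2.1 (hD.fst_curve e₁) (hD.fst_curve e₃) ?_
    filter_upwards [hD.eventually_xAt_lt h, hD.eventually_xAt_lt h'] with y hy hy'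
    exact hy.trans hy'

theorem outLt_trichotomous (hD : D.IsUpward) {x : V} {e e' : E} (he : e ∈ G.outEdges x)
    (he' : e' ∈ G.outEdges x) : D.outLt x e e' ∨ e = e' ∨ D.outLt x e' e := by
  obtain ⟨y, hxy, hy⟩ := exists_between (lt_min (bottom_eq he ▸ hD.bottom_lt_top e)
    (bottom_eq he' ▸ hD.bottom_lt_top e'))
  obtain ⟨hye, hye'⟩ := lt_min_iff.1 hy
  obtain hlt | heq | hgt := lt_trichotomy (hD.xAt e y) (hD.xAt e' y)
  · exact .inl (hD.outLt_of_xAt_lt he he' hxy hye.le hye'.le hlt)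
  · refine .inr (.inl (by_contra fun hne => hD.xAt_ne_xAt hne ?_ ?_ heq))
    exacts [⟨bottom_eq he ▸ hxy, hye⟩, ⟨bottom_eq he' ▸ hxy, hye'⟩]
  · exact .inr (.inr (hD.outLt_of_xAt_lt he' he hxy hye'.le hye.le hgt))

theorem strictlyInside_outLt [Finite E] (hD : D.IsUpward) {x : V} {m e M : E}
    (hm : D.outLt x m e) (hM : D.outLt x e M) : StrictlyInside (D.outLt x) (G.outEdges x) e :=
  have := hD.isStrictOrder_outLt x
  strictlyInside_of_lt_of_lt (fun _ he _ he' => hD.outLt_trichotomous he he') hm.1 hM.2.1 hm hM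

end IsUpward

end PlanarEmbedding

end DirGraph

/-! ### Free paths -/

namespace DirGraph.PlanarEmbedding

variable {V E : Type*} {G : DirGraph V E} {D : G.PlanarEmbedding}

/-- The point `p` lies outside the drawing. -/
def IsFree (D : G.PlanarEmbedding) (p : ℝ × ℝ) : Prop :=
  (∀ x, D.pos x ≠ p) ∧ ∀ e t, D.curve e t ≠ p

/-- No edge of an upward drawing reaches the point `p` from below: an edge may only pass through
`p` with its initial point. -/
def IsFreeBelow (D : G.PlanarEmbedding) (p : ℝ × ℝ) : Prop :=
  ∀ e t, t ≠ 0 → D.curve e t ≠ p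

theorem IsFree.isFreeBelow {p : ℝ × ℝ} (hp : D.IsFree p) : D.IsFreeBelow p :=
  fun e t _ => hp.2 e t

theorem isFreeBelow_pos_of_mem_sources {x : V} (hx : x ∈ G.sources) : D.IsFreeBelow (D.pos x) := by
  intro e t ht0 ht
  obtain rfl | ht1 := eq_or_ne t 1
  · exact mem_sources.1 hx e (D.pos_injective (D.curve_one e ▸ ht))
  · exact D.curve_ne_pos e t ⟨unitInterval.pos_iff_ne_zero.2 ht0,
      unitInterval.lt_one_iff_ne_one.2 ht1⟩ x ht

theorem IsFreeBelow.xAt_ne {p : ℝ × ℝ} (hp : D.IsFreeBelow p) (hD : D.IsUpward) {e : E}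
    (he : p.2 ∈ Ioc (D.bottom e) (D.top e)) : hD.xAt e p.2 ≠ p.1 := by
  intro hx
  obtain ⟨t, ht⟩ := hD.exists_curve_eq (Ioc_subset_Icc_self he)
  replace ht : D.curve e t = p := ht.trans (Prod.ext hx rfl)
  refine hp e t ?_ ht
  rintro rfl
  exact he.1.ne (by rw [← D.snd_curve_zero, ht])

theorem IsUpward.isFree_of_xAt_ne (hD : D.IsUpward) {p : ℝ × ℝ} (hpos : ∀ x, D.pos x ≠ p)
    (hxAt : ∀ e, p.2 ∈ Ico (D.bottom e) (D.top e) → hD.xAt e p.2 ≠ p.1) : D.IsFree p := by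
  refine ⟨hpos, ?_⟩
  rintro e t rfl
  obtain ⟨hbot, htop⟩ := hD.snd_curve_mem_Icc e t
  refine hxAt e ⟨hbot, htop.lt_of_ne fun h => hpos (G.tgt e) ?_⟩ (hD.fst_curve e t).symm
  rw [← D.curve_one, (hD e).injective (h.trans (D.snd_curve_one e).symm)]

/-- An upward path from `p` to `q` whose interior avoids the drawing, given by its horizontal
coordinate as a function of the height; the values at heights outside `[p.2, q.2]` are
irrelevant. -/
structure FreePath (D : G.PlanarEmbedding) (p q : ℝ × ℝ) where
  toFun : ℝ → ℝ
  snd_lt_snd : p.2 < q.2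
  continuous : Continuous toFun
  apply_left : toFun p.2 = p.1
  apply_right : toFun q.2 = q.1
  isFree : ∀ y ∈ Ioo p.2 q.2, D.IsFree (toFun y, y)

namespace FreePath

variable {p q r : ℝ × ℝ}

instance : CoeFun (D.FreePath p q) fun _ => ℝ → ℝ := ⟨toFun⟩

/-- The concatenation of two free paths at a point outside the drawing. -/
noncomputable def trans (γ : D.FreePath p q) (hq : D.IsFree q) (γ' : D.FreePath q r) :
    D.FreePath p r where
  toFun y := if y ≤ q.2 then γ y else γ' y
  snd_lt_snd := γ.snd_lt_snd.trans γ'.snd_lt_snd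
  continuous := γ.continuous.if_le γ'.continuous continuous_id continuous_const
    (by rintro _ rfl; exact γ.apply_right.trans γ'.apply_left.symm)
  apply_left := by rw [if_pos γ.snd_lt_snd.le, γ.apply_left]
  apply_right := by rw [if_neg γ'.snd_lt_snd.not_ge, γ'.apply_right]
  isFree y hy := by
    obtain hlt | rfl | hgt := lt_trichotomy y q.2
    · rw [if_pos hlt.le]
      exact γ.isFree y ⟨hy.1, hlt⟩
    · rw [if_pos le_rfl, γ.apply_right]
      exact hq
    · rw [if_neg hgt.not_ge]
      exact γ'.isFree y ⟨hgt, hy.2⟩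

/-- The free path `γ` leaves the vertex `w` between the outgoing edges `a` and `b`. -/
def LeavesBetween {w : V} (γ : D.FreePath (D.pos w) q) (hD : D.IsUpward) (a b : E) : Prop :=
  a ∈ G.outEdges w ∧ b ∈ G.outEdges w ∧
    ∀ᶠ y in 𝓝[>] (D.pos w).2, γ y ∈ Ioo (hD.xAt a y) (hD.xAt b y)

theorem LeavesBetween.trans {w : V} {γ : D.FreePath (D.pos w) q} {hD : D.IsUpward} {a b : E}
    (h : γ.LeavesBetween hD a b) (hq : D.IsFree q) (γ' : D.FreePath q r) :
    (γ.trans hq γ').LeavesBetween hD a b := by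
  refine ⟨h.1, h.2.1, ?_⟩
  filter_upwards [h.2.2, Ioo_mem_nhdsGT γ.snd_lt_snd] with y hy hyq
  simpa only [FreePath.trans, if_pos hyq.2.le] using hy

end FreePath

namespace IsUpward

/-- The edges to the left of `q`, among those present just below the height of `q`. -/
def leftEdges (hD : D.IsUpward) (q : ℝ × ℝ) : Set E :=
  {e | q.2 ∈ Ioc (D.bottom e) (D.top e) ∧ hD.xAt e q.2 < q.1}

/-- The edges to the right of `q`, among those present just below the height of `q`. -/
def rightEdges (hD : D.IsUpward) (q : ℝ × ℝ) : Set E :=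
  {e | q.2 ∈ Ioc (D.bottom e) (D.top e) ∧ q.1 < hD.xAt e q.2}

variable {l : ℝ} {q : ℝ × ℝ}

theorem bottom_le_of_strip (hstrip : ∀ x, (D.pos x).2 ∉ Ioo l q.2) {e : E} (he : D.bottom e < q.2) :
    D.bottom e ≤ l := not_lt.1 fun h => hstrip _ ⟨h, he⟩

theorem mem_leftEdges_or_mem_rightEdges (hD : D.IsUpward) (hq : D.IsFreeBelow q)
    (hstrip : ∀ x, (D.pos x).2 ∉ Ioo l q.2) {y : ℝ} (hy : y ∈ Ico l q.2) {e : E}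
    (he : y ∈ Ico (D.bottom e) (D.top e)) : e ∈ hD.leftEdges q ∨ e ∈ hD.rightEdges q := by
  have hqe : q.2 ∈ Ioc (D.bottom e) (D.top e) :=
    ⟨he.1.trans_lt hy.2, not_lt.1 fun h => hstrip _ ⟨hy.1.trans_lt he.2, h⟩⟩
  exact (hq.xAt_ne hD hqe).lt_or_gt.imp (⟨hqe, ·⟩) (⟨hqe, ·⟩)

theorem xAt_lt_xAt_of_mem_leftEdges (hD : D.IsUpward) (hstrip : ∀ x, (D.pos x).2 ∉ Ioo l q.2)
    {a b : E} (ha : a ∈ hD.leftEdges q) (hb : b ∈ hD.rightEdges q) {y : ℝ} (hy : y ∈ Ioo l q.2) :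
    hD.xAt a y < hD.xAt b y :=
  hD.xAt_lt_xAt_of_le hy.2.le (ha.2.trans hb.2) ((bottom_le_of_strip hstrip ha.1.1).trans_lt hy.1)
    ((bottom_le_of_strip hstrip hb.1.1).trans_lt hy.1) ha.1.2 hb.1.2

theorem xAt_le_xAt_of_mem_leftEdges (hD : D.IsUpward) (hstrip : ∀ x, (D.pos x).2 ∉ Ioo l q.2)
    (hl : l < q.2) {a b : E} (ha : a ∈ hD.leftEdges q) (hb : b ∈ hD.rightEdges q) :
    hD.xAt a l ≤ hD.xAt b l := by
  refine le_of_tendsto_of_tendsto ((hD.continuous_xAt a).continuousWithinAt (s := Ioi l))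
    ((hD.continuous_xAt b).continuousWithinAt (s := Ioi l)) ?_
  filter_upwards [Ioo_mem_nhdsGT hl] with y hy
  exact (hD.xAt_lt_xAt_of_mem_leftEdges hstrip ha hb hy).le

theorem exists_freePath_of_strip [Finite E] (hD : D.IsUpward) {p : ℝ × ℝ} (hq : D.IsFreeBelow q)
    (hstrip : ∀ x, (D.pos x).2 ∉ Ioo p.2 q.2) (hpq : p.2 < q.2)
    (hleft : ∀ a ∈ hD.leftEdges q, hD.xAt a p.2 ≤ p.1)
    (hright : ∀ b ∈ hD.rightEdges q, p.1 ≤ hD.xAt b p.2) :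
    ∃ γ : D.FreePath p q, ∀ y ∈ Ioo p.2 q.2,
      (∀ a ∈ hD.leftEdges q, hD.xAt a y < γ y) ∧ ∀ b ∈ hD.rightEdges q, γ y < hD.xAt b y := by
  have mem_left := fun e => (toFinite (hD.leftEdges q)).mem_toFinset (a := e)
  have mem_right := fun e => (toFinite (hD.rightEdges q)).mem_toFinset (a := e)
  obtain ⟨g, hg, hgp, hgq, hbetween⟩ := exists_continuous_between_finset
    (toFinite (hD.leftEdges q)).toFinset (toFinite (hD.rightEdges q)).toFinset
    hD.continuous_xAt (x' := p.1) (x := q.1) hpq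
    (by simpa only [mem_left, mem_right] using fun a ha b hb y =>
      hD.xAt_lt_xAt_of_mem_leftEdges hstrip ha hb)
    (by simpa only [mem_left] using hleft) (by simpa only [mem_right] using hright)
    (by simpa only [mem_left] using fun a ha => ha.2)
    (by simpa only [mem_right] using fun b hb => hb.2)
  simp only [mem_left, mem_right] at hbetween
  refine ⟨⟨g, hpq, hg, hgp, hgq, fun y hy => hD.isFree_of_xAt_ne ?_ fun e he => ?_⟩, hbetween⟩
  · exact fun v hv => hstrip v (by rwa [hv])
  · obtain h | h := hD.mem_leftEdges_or_mem_rightEdges hq hstrip (Ioo_subset_Ico_self hy) he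
    exacts [((hbetween y hy).1 e h).ne, ((hbetween y hy).2 e h).ne']

theorem exists_freePath_of_strip_of_xAt_lt [Finite V] [Finite E] (hD : D.IsUpward)
    (hq : D.IsFreeBelow q) (hstrip : ∀ x, (D.pos x).2 ∉ Ioo l q.2) (hl : l < q.2)
    (hlt : ∀ a ∈ hD.leftEdges q, ∀ b ∈ hD.rightEdges q, hD.xAt a l < hD.xAt b l) :
    ∃ x, D.IsFree (x, l) ∧ Nonempty (D.FreePath (x, l) q) := by
  obtain ⟨x, hleft, hright, hpos⟩ := exists_between_finset_notMem
    (toFinite ((hD.xAt · l) '' hD.leftEdges q)).toFinset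
    (toFinite ((hD.xAt · l) '' hD.rightEdges q)).toFinset
    (toFinite (range fun v => (D.pos v).1)).toFinset
    (by simpa only [Finite.mem_toFinset, forall_mem_image] using hlt)
  simp only [Finite.mem_toFinset, forall_mem_image, mem_range, not_exists] at hleft hright hpos
  obtain ⟨γ, -⟩ := hD.exists_freePath_of_strip (p := (x, l)) hq hstrip hl
    (fun a ha => (hleft ha).le) (fun b hb => (hright hb).le)
  refine ⟨x, hD.isFree_of_xAt_ne (fun v hv => hpos v (by rw [hv])) fun e he => ?_, ⟨γ⟩⟩
  obtain h | h := hD.mem_leftEdges_or_mem_rightEdges hq hstrip (left_mem_Ico.2 hl) he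
  exacts [(hleft h).ne, (hright h).ne']

theorem exists_leavesBetween_of_strip_of_xAt_eq [Finite E] (hD : D.IsUpward)
    (hq : D.IsFreeBelow q) (hstrip : ∀ x, (D.pos x).2 ∉ Ioo l q.2) (hl : l < q.2) {a b : E}
    (ha : a ∈ hD.leftEdges q) (hb : b ∈ hD.rightEdges q) (hab : hD.xAt a l = hD.xAt b l) :
    ∃ (w : V) (γ : D.FreePath (D.pos w) q), γ.LeavesBetween hD a b := by
  have hla : l ∈ Ico (D.bottom a) (D.top a) :=
    ⟨bottom_le_of_strip hstrip ha.1.1, hl.trans_le ha.1.2⟩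
  have hlb : l ∈ Ico (D.bottom b) (D.top b) :=
    ⟨bottom_le_of_strip hstrip hb.1.1, hl.trans_le hb.1.2⟩
  have hne : a ≠ b := by
    rintro rfl
    exact (ha.2.trans hb.2).false
  have hw : D.pos (G.src a) = (hD.xAt a l, l) := hD.pos_src_eq_of_xAt_eq hne hla hlb hab
  have hw₁ : (D.pos (G.src a)).1 = hD.xAt a l := congrArg Prod.fst hw
  obtain rfl : (D.pos (G.src a)).2 = l := congrArg Prod.snd hw
  obtain ⟨γ, hγ⟩ := hD.exists_freePath_of_strip hq hstrip hl
    (fun a' ha' => by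
      rw [hw₁, hab]
      exact hD.xAt_le_xAt_of_mem_leftEdges hstrip hl ha' hb)
    (fun b' hb' => by
      rw [hw₁]
      exact hD.xAt_le_xAt_of_mem_leftEdges hstrip hl ha hb')
  refine ⟨G.src a, γ, rfl, (hD.src_eq_src_of_xAt_eq hla hlb hab).symm, ?_⟩
  filter_upwards [Ioo_mem_nhdsGT hl] with y hy
  exact ⟨(hγ y hy).1 a ha, (hγ y hy).2 b hb⟩

theorem exists_freePath_or_leavesBetween_of_strip [Finite V] [Finite E] (hD : D.IsUpward)
    (hq : D.IsFreeBelow q) (hstrip : ∀ x, (D.pos x).2 ∉ Ioo l q.2) (hl : l < q.2) :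
    (∃ x, D.IsFree (x, l) ∧ Nonempty (D.FreePath (x, l) q)) ∨
      ∃ (w : V) (γ : D.FreePath (D.pos w) q) (a b : E), γ.LeavesBetween hD a b := by
  by_cases hlt : ∀ a ∈ hD.leftEdges q, ∀ b ∈ hD.rightEdges q, hD.xAt a l < hD.xAt b l
  · exact .inl (hD.exists_freePath_of_strip_of_xAt_lt hq hstrip hl hlt)
  · push Not at hlt
    obtain ⟨a, ha, b, hb, hle⟩ := hlt
    have hab := (hD.xAt_le_xAt_of_mem_leftEdges hstrip hl ha hb).antisymm hle
    obtain ⟨w, γ, hγ⟩ := hD.exists_leavesBetween_of_strip_of_xAt_eq hq hstrip hl ha hb hab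
    exact .inr ⟨w, γ, a, b, hγ⟩

theorem exists_freePath_or_leavesBetween [Finite V] [Finite E] (hD : D.IsUpward)
    (hq : D.IsFreeBelow q) {c : ℝ} (hc : c < q.2) :
    (∃ x, D.IsFree (x, c) ∧ Nonempty (D.FreePath (x, c) q)) ∨
      ∃ (w : V) (γ : D.FreePath (D.pos w) q) (a b : E), γ.LeavesBetween hD a b := by
  induction hn : {v | (D.pos v).2 ∈ Ioo c q.2}.ncard using Nat.strong_induction_on generalizing q
    with | _ n ih
  subst hn
  obtain hempty | hnonempty := {v | (D.pos v).2 ∈ Ioo c q.2}.eq_empty_or_nonempty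
  · exact hD.exists_freePath_or_leavesBetween_of_strip hq (eq_empty_iff_forall_notMem.1 hempty) hc
  obtain ⟨v, hv, hmax⟩ := exists_max_image _ (fun v => (D.pos v).2) (toFinite _) hnonempty
  have hstrip : ∀ x, (D.pos x).2 ∉ Ioo (D.pos v).2 q.2 :=
    fun x hx => (hmax x ⟨hv.1.trans hx.1, hx.2⟩).not_gt hx.1
  obtain ⟨x, hx, ⟨γ⟩⟩ | h := hD.exists_freePath_or_leavesBetween_of_strip hq hstrip hv.2
  · have hssub : {w | (D.pos w).2 ∈ Ioo c (D.pos v).2} ⊂ {w | (D.pos w).2 ∈ Ioo c q.2} :=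
      ⟨fun w hw => ⟨hw.1, hw.2.trans hv.2⟩, fun hsub => (hsub hv).2.false⟩
    obtain ⟨x', hx', ⟨γ'⟩⟩ | ⟨w, γ', a, b, h⟩ :=
      ih _ (ncard_lt_ncard hssub) (q := (x, (D.pos v).2)) hx.isFreeBelow hv.1 rfl
    · exact .inl ⟨x', hx', ⟨γ'.trans hx γ⟩⟩
    · exact .inr ⟨w, γ'.trans hx γ, a, b, h.trans hx γ⟩
  · exact .inr h

end IsUpward

end DirGraph.PlanarEmbedding

/-! ### Extensions of drawings -/

namespace DirGraph

variable {V E W F X Y : Type*} {G : DirGraph V E} {H : DirGraph W F} {K : DirGraph X Y}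

/-- The graph `G` with an additional isolated vertex `none`. -/
def addVertex (G : DirGraph V E) : DirGraph (Option V) E where
  src e := some (G.src e)
  tgt e := some (G.tgt e)

/-- The graph `G` with an additional edge `none` from `a` to `b`. -/
def addEdge (G : DirGraph V E) (a b : V) : DirGraph V (Option E) where
  src e := e.elim a G.src
  tgt e := e.elim b G.tgt

/-- The graph `G` with all edges reversed. -/
def reverse (G : DirGraph V E) : DirGraph V E where
  src := G.tgt
  tgt := G.src

theorem degree_reverse (G : DirGraph V E) (x : V) : G.reverse.degree x = G.degree x := add_comm _ _

namespace Embedding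

/-- The identity embedding. -/
protected def refl (G : DirGraph V E) : G.Embedding G where
  onVert := .refl V
  onEdge := .refl E
  src_onEdge _ := rfl
  tgt_onEdge _ := rfl

/-- The composition of two embeddings. -/
protected def trans (φ : G.Embedding H) (ψ : H.Embedding K) : G.Embedding K where
  onVert := φ.onVert.trans ψ.onVert
  onEdge := φ.onEdge.trans ψ.onEdge
  src_onEdge e := by simp [ψ.src_onEdge, φ.src_onEdge]
  tgt_onEdge e := by simp [ψ.tgt_onEdge, φ.tgt_onEdge]

/-- An embedding, regarded as an embedding of the reversed graphs. -/
protected def reverse (φ : G.Embedding H) : G.reverse.Embedding H.reverse where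
  onVert := φ.onVert
  onEdge := φ.onEdge
  src_onEdge := φ.tgt_onEdge
  tgt_onEdge := φ.src_onEdge

/-- The inclusion of a graph into the graph with an additional vertex. -/
def toAddVertex (G : DirGraph V E) : G.Embedding G.addVertex where
  onVert := .some
  onEdge := .refl E
  src_onEdge _ := rfl
  tgt_onEdge _ := rfl

/-- The inclusion of a graph into the graph with an additional edge. -/
def toAddEdge (G : DirGraph V E) (a b : V) : G.Embedding (G.addEdge a b) where
  onVert := .refl V
  onEdge := .some
  src_onEdge _ := rfl
  tgt_onEdge _ := rfl

/-- The vertices that do not come from the smaller graph. -/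
def newVerts (φ : G.Embedding H) : Set W := (range φ.onVert)ᶜ

/-- The edges that do not come from the smaller graph. -/
def newEdges (φ : G.Embedding H) : Set F := (range φ.onEdge)ᶜ

theorem newVerts_trans (φ : G.Embedding H) (ψ : H.Embedding K) :
    (φ.trans ψ).newVerts = ψ.newVerts ∪ ψ.onVert '' φ.newVerts := by
  change (range (ψ.onVert ∘ φ.onVert))ᶜ = _
  rw [range_comp, ψ.onVert.injective.compl_image_eq, union_comm]
  rfl

theorem newEdges_trans (φ : G.Embedding H) (ψ : H.Embedding K) :
    (φ.trans ψ).newEdges = ψ.newEdges ∪ ψ.onEdge '' φ.newEdges := by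
  change (range (ψ.onEdge ∘ φ.onEdge))ᶜ = _
  rw [range_comp, ψ.onEdge.injective.compl_image_eq, union_comm]
  rfl

/-- The drawing `D'` of the larger graph extends the drawing `D` of the smaller one. -/
structure Extends (φ : G.Embedding H) (D : G.PlanarEmbedding) (D' : H.PlanarEmbedding) : Prop where
  pos_onVert : ∀ x, D'.pos (φ.onVert x) = D.pos x
  curve_onEdge : ∀ e, D'.curve (φ.onEdge e) = D.curve e

namespace Extends

variable {φ : G.Embedding H} {ψ : H.Embedding K} {D : G.PlanarEmbedding} {D' : H.PlanarEmbedding}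
  {D'' : K.PlanarEmbedding}

protected theorem trans (h : φ.Extends D D') (h' : ψ.Extends D' D'') :
    (φ.trans ψ).Extends D D'' where
  pos_onVert x := (h'.pos_onVert _).trans (h.pos_onVert x)
  curve_onEdge e := (h'.curve_onEdge _).trans (h.curve_onEdge e)

theorem outLt (h : φ.Extends D D') {x : V} {e e' : E} (hlt : D.outLt x e e') :
    D'.outLt (φ.onVert x) (φ.onEdge e) (φ.onEdge e') := by
  obtain ⟨he, he', hδ⟩ := hlt
  refine ⟨(φ.src_onEdge e).trans (congrArg _ he), (φ.src_onEdge e').trans (congrArg _ he'), ?_⟩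
  rwa [h.pos_onVert, h.curve_onEdge, h.curve_onEdge]

end Extends

end Embedding

namespace PlanarEmbedding

variable {D : G.PlanarEmbedding}

namespace FreePath

variable {p q : ℝ × ℝ}

/-- The parametrization of a free path in which the height increases at constant speed. -/
noncomputable def curve (γ : D.FreePath p q) (t : unitInterval) : ℝ × ℝ :=
  (γ (AffineMap.lineMap p.2 q.2 (t : ℝ)), AffineMap.lineMap p.2 q.2 (t : ℝ))

variable (γ : D.FreePath p q)

theorem continuous_curve : Continuous γ.curve := by
  have height : Continuous fun t : unitInterval => AffineMap.lineMap p.2 q.2 (t : ℝ) :=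
    AffineMap.lineMap_continuous.comp continuous_subtype_val
  exact (γ.continuous.comp height).prodMk height

theorem curve_zero : γ.curve 0 = p := by simp [curve, γ.apply_left]

theorem curve_one : γ.curve 1 = q := by simp [curve, γ.apply_right]

theorem strictMono_snd_curve : StrictMono fun t => (γ.curve t).2 :=
  fun _ _ hst => (lineMap_lt_lineMap_iff_of_lt (Subtype.coe_lt_coe.2 hst)).2 γ.snd_lt_snd

theorem isFree_curve {t : unitInterval} (ht : t ∈ Ioo 0 1) : D.IsFree (γ.curve t) :=
  γ.isFree _ ⟨(left_lt_lineMap_iff_lt ht.1).2 γ.snd_lt_snd,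
    (lineMap_lt_right_iff_lt ht.2).2 γ.snd_lt_snd⟩

end FreePath

/-- The drawing `D` with an additional isolated vertex at the point `p`. -/
def addVertex (D : G.PlanarEmbedding) (p : ℝ × ℝ) (hp : D.IsFree p) :
    G.addVertex.PlanarEmbedding where
  pos x := x.elim p D.pos
  curve := D.curve
  pos_injective := by
    rintro (_ | x) (_ | y) h
    · rfl
    · exact absurd h.symm (hp.1 y)
    · exact absurd h (hp.1 x)
    · exact congrArg some (D.pos_injective h)
  continuous_curve := D.continuous_curve
  curve_zero := D.curve_zero
  curve_one := D.curve_one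
  injOn_curve := D.injOn_curve
  curve_ne_pos := by
    rintro e t ht (_ | x)
    · exact hp.2 e t
    · exact D.curve_ne_pos e t ht x
  curve_ne_curve := D.curve_ne_curve

/-- A free path remains free when its starting point becomes a vertex. -/
def FreePath.addVertex {p q : ℝ × ℝ} (γ : D.FreePath p q) (hp : D.IsFree p) :
    (D.addVertex p hp).FreePath p q where
  __ := γ
  isFree y hy := by
    refine ⟨?_, (γ.isFree y hy).2⟩
    rintro (_ | x) h
    · exact hy.1.ne (congrArg Prod.snd h)
    · exact (γ.isFree y hy).1 x h

/-- The drawing `D` with an additional edge along a free path between two vertices. -/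
noncomputable def addEdge (D : G.PlanarEmbedding) {a b : V} (γ : D.FreePath (D.pos a) (D.pos b)) :
    (G.addEdge a b).PlanarEmbedding where
  pos := D.pos
  curve e := e.elim γ.curve D.curve
  pos_injective := D.pos_injective
  continuous_curve := by
    rintro (_ | e)
    exacts [γ.continuous_curve, D.continuous_curve e]
  curve_zero := by
    rintro (_ | e)
    exacts [γ.curve_zero, D.curve_zero e]
  curve_one := by
    rintro (_ | e)
    exacts [γ.curve_one, D.curve_one e]
  injOn_curve := by
    rintro (_ | e)
    · exact fun s _ t _ h => γ.strictMono_snd_curve.injective (congrArg Prod.snd h)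
    · exact D.injOn_curve e
  curve_ne_pos := by
    rintro (_ | e) t ht x
    · exact ((γ.isFree_curve ht).1 x).symm
    · exact D.curve_ne_pos e t ht x
  curve_ne_curve := by
    rintro (_ | e) (_ | e') hne t ht t' ht'
    · exact absurd rfl hne
    · exact ((γ.isFree_curve ht).2 e' t').symm
    · exact (γ.isFree_curve ht').2 e t
    · exact D.curve_ne_curve e e' (hne <| congrArg some ·) t ht t' ht'

theorem extends_addVertex {p : ℝ × ℝ} (hp : D.IsFree p) :
    (Embedding.toAddVertex G).Extends D (D.addVertex p hp) := ⟨fun _ => rfl, fun _ => rfl⟩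

theorem extends_addEdge {a b : V} (γ : D.FreePath (D.pos a) (D.pos b)) :
    (Embedding.toAddEdge G a b).Extends D (D.addEdge γ) := ⟨fun _ => rfl, fun _ => rfl⟩

theorem IsUpward.addVertex (hD : D.IsUpward) {p : ℝ × ℝ} (hp : D.IsFree p) :
    (D.addVertex p hp).IsUpward := hD

theorem IsUpward.addEdge (hD : D.IsUpward) {a b : V} (γ : D.FreePath (D.pos a) (D.pos b)) :
    (D.addEdge γ).IsUpward := by
  rintro (_ | e)
  exacts [γ.strictMono_snd_curve, hD e]

theorem FreePath.LeavesBetween.outLt_addEdge {hD : D.IsUpward} {w v : V}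
    {γ : D.FreePath (D.pos w) (D.pos v)} {a b : E} (h : γ.LeavesBetween hD a b) :
    (D.addEdge γ).outLt w (some a) none ∧ (D.addEdge γ).outLt w none (some b) := by
  obtain ⟨ha, hb, hbetween⟩ := h
  constructor
  · exact outLt_of_eventually_lt ha rfl (hD.fst_curve a) (fun _ => rfl)
      (hbetween.mono fun _ => And.left)
  · exact outLt_of_eventually_lt rfl hb (fun _ => rfl) (hD.fst_curve b)
      (hbetween.mono fun _ => And.right)

/-- The reflection of the plane in the horizontal axis. -/
def mirror (p : ℝ × ℝ) : ℝ × ℝ := (p.1, -p.2)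

theorem mirror_mirror (p : ℝ × ℝ) : mirror (mirror p) = p := by simp [mirror]

theorem mirror_injective : Function.Injective mirror :=
  Function.LeftInverse.injective mirror_mirror

theorem symm_mem_Ioo {t : unitInterval} (ht : t ∈ Ioo 0 1) : unitInterval.symm t ∈ Ioo 0 1 := by
  simpa [unitInterval.pos_iff_ne_zero, unitInterval.lt_one_iff_ne_one, and_comm] using ht

/-- The mirror image of a drawing in the horizontal axis, a drawing of the reversed graph. -/
def reflect (D : G.PlanarEmbedding) : G.reverse.PlanarEmbedding where
  pos x := mirror (D.pos x)
  curve e t := mirror (D.curve e (unitInterval.symm t))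
  pos_injective := mirror_injective.comp D.pos_injective
  continuous_curve e := by
    have := D.continuous_curve e
    unfold mirror
    fun_prop
  curve_zero e := by rw [unitInterval.symm_zero, D.curve_one]; rfl
  curve_one e := by rw [unitInterval.symm_one, D.curve_zero]; rfl
  injOn_curve e s hs t ht h := unitInterval.symm_bijective.injective
    (D.injOn_curve e (symm_mem_Ioo hs) (symm_mem_Ioo ht) (mirror_injective h))
  curve_ne_pos e t ht x h := D.curve_ne_pos e _ (symm_mem_Ioo ht) x (mirror_injective h)
  curve_ne_curve e e' hne t ht t' ht' h :=
    D.curve_ne_curve e e' hne _ (symm_mem_Ioo ht) _ (symm_mem_Ioo ht') (mirror_injective h)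

theorem reflect_reflect (D : G.PlanarEmbedding) : D.reflect.reflect = D := by
  cases D
  simp only [reflect, mirror_mirror, unitInterval.symm_symm]
  rfl

theorem IsUpward.reflect (hD : D.IsUpward) : D.reflect.IsUpward :=
  fun e _ _ hst => neg_lt_neg (hD e (unitInterval.symm_lt_symm.2 hst))

theorem outLt_reflect (D : G.PlanarEmbedding) (x : V) : D.reflect.outLt x = D.inLt x := by
  ext e e'
  refine and_congr Iff.rfl (and_congr Iff.rfl (exists_congr fun δ => and_congr Iff.rfl ?_))
  rw [unitInterval.symm_bijective.surjective.forall₂]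
  simp only [reflect, mirror, unitInterval.symm_symm, neg_inj, neg_mem_Ioo_iff, neg_neg,
    neg_sub, neg_add_eq_sub]

theorem IsUpward.strictlyInside_inLt [Finite E] (hD : D.IsUpward) {x : V} {m e M : E}
    (hm : D.inLt x m e) (hM : D.inLt x e M) : StrictlyInside (D.inLt x) (G.inEdges x) e := by
  rw [← outLt_reflect] at hm hM ⊢
  exact hD.reflect.strictlyInside_outLt hm hM

end PlanarEmbedding

theorem Embedding.Extends.reflect {φ : G.Embedding H} {D : G.PlanarEmbedding}
    {D' : H.PlanarEmbedding} (h : φ.Extends D D') : φ.reverse.Extends D.reflect D'.reflect where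
  pos_onVert x := congrArg PlanarEmbedding.mirror (h.pos_onVert x)
  curve_onEdge e := funext fun _ => congrArg PlanarEmbedding.mirror (congrFun (h.curve_onEdge e) _)

end DirGraph

/-! ### Completions -/

namespace DirGraph

open PlanarEmbedding

variable {V E W F X Y : Type*} {G : DirGraph V E} {H : DirGraph W F} {K : DirGraph X Y}
  {D : G.PlanarEmbedding} {D' : H.PlanarEmbedding} {D'' : K.PlanarEmbedding}
  {φ : G.Embedding H} {ψ : H.Embedding K} {c d : ℝ} {S T : Set V}

/-- The upward drawing `D'` arises from `D` by drawing one new edge to each source in `S`. A new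
edge starts either at a new vertex, all of which have height `c` and are the start of one edge, or
at an old vertex, where it leaves between two old edges. -/
structure IsSourceCompletion (φ : G.Embedding H) (D : G.PlanarEmbedding) (D' : H.PlanarEmbedding)
    (c : ℝ) (S : Set V) : Prop extends φ.Extends D D' where
  isUpward : D'.IsUpward
  subset_sources : S ⊆ G.sources
  snd_pos_of_mem_newVerts : ∀ w ∈ φ.newVerts, (D'.pos w).2 = c
  existsUnique_src_eq : ∀ w ∈ φ.newVerts, ∃! f, H.src f = w
  bijOn_tgt : BijOn H.tgt φ.newEdges (φ.onVert '' S)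
  src_mem_newVerts_or_between : ∀ f ∈ φ.newEdges, H.src f ∈ φ.newVerts ∨
    ∃ m M, D'.outLt (H.src f) (φ.onEdge m) f ∧ D'.outLt (H.src f) f (φ.onEdge M)

namespace IsSourceCompletion

theorem src_ne_onVert (h : IsSourceCompletion φ D D' c S) {x : V}
    (hx : (G.outEdges x).Subsingleton) {f : F} (hf : f ∈ φ.newEdges) : H.src f ≠ φ.onVert x := by
  intro hsrc
  obtain hnew | ⟨m, M, hm, hM⟩ := h.src_mem_newVerts_or_between f hf
  · exact hnew ⟨x, hsrc.symm⟩
  have mem_outEdges : ∀ e, φ.onEdge e ∈ H.outEdges (H.src f) → e ∈ G.outEdges x := fun e he =>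
    φ.onVert.injective ((φ.src_onEdge e).symm.trans (he.out.trans hsrc))
  have := h.isUpward.isStrictOrder_outLt (H.src f)
  rw [hx (mem_outEdges m hm.1) (mem_outEdges M hM.2.1)] at hm
  exact asymm hm hM

theorem outEdges_onVert (h : IsSourceCompletion φ D D' c S) {x : V}
    (hx : (G.outEdges x).Subsingleton) : H.outEdges (φ.onVert x) = φ.onEdge '' G.outEdges x := by
  ext f
  constructor
  · intro hf
    obtain ⟨e, rfl⟩ := not_notMem.1 fun hnew => h.src_ne_onVert hx hnew hf
    exact ⟨e, φ.onVert.injective ((φ.src_onEdge e).symm.trans hf), rfl⟩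
  · rintro ⟨e, rfl, rfl⟩
    exact φ.src_onEdge e

theorem inEdges_onVert (h : IsSourceCompletion φ D D' c S) {x : V} (hx : x ∉ S) :
    H.inEdges (φ.onVert x) = φ.onEdge '' G.inEdges x := by
  ext f
  constructor
  · intro hf
    obtain ⟨e, rfl⟩ := not_notMem.1 fun hnew => hx <| by
      obtain ⟨y, hy, hyf⟩ := h.bijOn_tgt.mapsTo hnew
      rwa [← φ.onVert.injective (hyf.trans hf)]
    exact ⟨e, φ.onVert.injective ((φ.tgt_onEdge e).symm.trans hf), rfl⟩
  · rintro ⟨e, rfl, rfl⟩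
    exact φ.tgt_onEdge e

theorem onVert_mem_sources_iff (h : IsSourceCompletion φ D D' c S) {x : V} :
    φ.onVert x ∈ H.sources ↔ x ∈ G.sources ∧ x ∉ S := by
  by_cases hx : x ∈ S
  · obtain ⟨f, -, hf⟩ := h.bijOn_tgt.surjOn (mem_image_of_mem _ hx)
    simp only [hx, not_true_eq_false, and_false, iff_false]
    exact fun hsource => mem_sources.1 hsource f hf
  · simp only [sources, mem_ofPred_eq, h.inEdges_onVert hx, image_eq_empty, hx, not_false_eq_true,
      and_true]

theorem newVerts_subset_sources (h : IsSourceCompletion φ D D' c S) : φ.newVerts ⊆ H.sources := by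
  rintro w hw
  refine mem_sources.2 fun f hf => hw ?_
  subst hf
  by_cases hf : f ∈ φ.newEdges
  · exact image_subset_range _ _ (h.bijOn_tgt.mapsTo hf)
  · obtain ⟨e, rfl⟩ := not_notMem.1 hf
    exact ⟨G.tgt e, (φ.tgt_onEdge e).symm⟩

theorem sources_eq (h : IsSourceCompletion φ D D' c G.sources) : H.sources = φ.newVerts := by
  refine Subset.antisymm ?_ h.newVerts_subset_sources
  rintro _ hw ⟨x, rfl⟩
  exact (h.onVert_mem_sources_iff.1 hw).2 (h.onVert_mem_sources_iff.1 hw).1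

theorem sinks_eq (h : IsSourceCompletion φ D D' c S) : H.sinks = φ.onVert '' G.sinks := by
  have onVert_mem_sinks : ∀ x, φ.onVert x ∈ H.sinks ↔ x ∈ G.sinks := by
    intro x
    constructor
    · exact fun hx => mem_sinks.2 fun e he =>
        mem_sinks.1 hx (φ.onEdge e) ((φ.src_onEdge e).trans (congrArg _ he))
    · intro hx
      have hx : G.outEdges x = ∅ := hx
      rw [sinks, mem_ofPred_eq, h.outEdges_onVert (by simp [hx]), hx, image_empty]
  ext w
  constructor
  · intro hw
    obtain ⟨x, rfl⟩ := not_notMem.1 fun hnew =>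
      let ⟨f, hf⟩ := (h.existsUnique_src_eq w hnew).exists
      mem_sinks.1 hw f hf
    exact ⟨x, (onVert_mem_sinks x).1 hw, rfl⟩
  · rintro ⟨x, hx, rfl⟩
    exact (onVert_mem_sinks x).2 hx

theorem outEdges_subsingleton_of_mem_newVerts (h : IsSourceCompletion φ D D' c S) {w : W}
    (hw : w ∈ φ.newVerts) : (H.outEdges w).Subsingleton :=
  fun _ hf _ hf' => (h.existsUnique_src_eq w hw).unique hf hf'

theorem inEdges_onVert_subsingleton (h : IsSourceCompletion φ D D' c S) {x : V} (hx : x ∈ S) :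
    (H.inEdges (φ.onVert x)).Subsingleton := by
  have mem_newEdges : ∀ f ∈ H.inEdges (φ.onVert x), f ∈ φ.newEdges := by
    rintro _ hf ⟨e, rfl⟩
    exact mem_sources.1 (h.subset_sources hx) e
      (φ.onVert.injective ((φ.tgt_onEdge e).symm.trans hf))
  exact fun f hf f' hf' =>
    h.bijOn_tgt.injOn (mem_newEdges f hf) (mem_newEdges f' hf') (hf.trans hf'.symm)

theorem degree_of_mem_newVerts (h : IsSourceCompletion φ D D' c S) {w : W}
    (hw : w ∈ φ.newVerts) : H.degree w = 1 := by
  obtain ⟨f, hf, hunique⟩ := h.existsUnique_src_eq w hw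
  have hin : H.inEdges w = ∅ := h.newVerts_subset_sources hw
  have hout : H.outEdges w = {f} := Subset.antisymm hunique (singleton_subset_iff.2 hf)
  rw [degree, hin, hout, ncard_empty, ncard_singleton]

theorem degree_onVert (h : IsSourceCompletion φ D D' c S) {x : V} (hx : x ∉ S)
    (hout : (G.outEdges x).Subsingleton) : H.degree (φ.onVert x) = G.degree x := by
  rw [degree, h.inEdges_onVert hx, h.outEdges_onVert hout,
    ncard_image_of_injective _ φ.onEdge.injective, ncard_image_of_injective _ φ.onEdge.injective,
    degree]

theorem card_edges [Finite F] (h : IsSourceCompletion φ D D' c S) :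
    Nat.card F = Nat.card E + S.ncard := by
  rw [← ncard_image_of_injective S φ.onVert.injective, ← h.bijOn_tgt.ncard_eq,
    ← ncard_range_of_injective φ.onEdge.injective]
  exact (ncard_add_ncard_compl (range φ.onEdge)).symm

theorem exists_onEdge_between (h : IsSourceCompletion φ D D' c S) {x : V} {f : F}
    (hf : f ∈ H.outEdges (φ.onVert x)) : ∃ m M,
      (φ.onEdge m = f ∨ D'.outLt (φ.onVert x) (φ.onEdge m) f) ∧
      (φ.onEdge M = f ∨ D'.outLt (φ.onVert x) f (φ.onEdge M)) := by
  by_cases hnew : f ∈ φ.newEdges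
  · obtain hsrc | ⟨m, M, hm, hM⟩ := h.src_mem_newVerts_or_between f hnew
    · exact absurd ⟨x, hf.symm⟩ hsrc
    · rw [hf.out] at hm hM
      exact ⟨m, M, .inr hm, .inr hM⟩
  · obtain ⟨e, rfl⟩ := not_notMem.1 hnew
    exact ⟨e, e, .inl rfl, .inl rfl⟩

protected theorem refl (hD : D.IsUpward) : IsSourceCompletion (.refl G) D D c ∅ where
  pos_onVert _ := rfl
  curve_onEdge _ := rfl
  isUpward := hD
  subset_sources := empty_subset _
  snd_pos_of_mem_newVerts w hw := absurd ⟨w, rfl⟩ hw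
  existsUnique_src_eq w hw := absurd ⟨w, rfl⟩ hw
  bijOn_tgt := by
    have newEdges_eq : (Embedding.refl G).newEdges = ∅ := compl_empty_iff.2 range_id
    rw [newEdges_eq, image_empty]
    exact bijOn_empty _
  src_mem_newVerts_or_between f hf := absurd ⟨f, rfl⟩ hf

theorem addEdge (hD : D.IsUpward) {v w : V} (hv : v ∈ G.sources)
    {γ : D.FreePath (D.pos w) (D.pos v)} {a b : E} (hγ : γ.LeavesBetween hD a b) :
    IsSourceCompletion (.toAddEdge G w v) D (D.addEdge γ) c {v} where
  toExtends := extends_addEdge γ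
  isUpward := hD.addEdge γ
  subset_sources := singleton_subset_iff.2 hv
  snd_pos_of_mem_newVerts x hx := absurd ⟨x, rfl⟩ hx
  existsUnique_src_eq x hx := absurd ⟨x, rfl⟩ hx
  bijOn_tgt := by
    have newEdges_eq : (Embedding.toAddEdge G w v).newEdges = {none} := compl_range_some E
    rw [newEdges_eq, image_singleton]
    exact bijOn_singleton.2 rfl
  src_mem_newVerts_or_between := by
    rintro (_ | e) he
    · exact .inr ⟨a, b, hγ.outLt_addEdge⟩
    · exact absurd ⟨e, rfl⟩ he

theorem addVertex_addEdge (hD : D.IsUpward) {v : V} (hv : v ∈ G.sources) {x : ℝ}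
    (hx : D.IsFree (x, c)) (γ : D.FreePath (x, c) (D.pos v)) :
    IsSourceCompletion ((Embedding.toAddVertex G).trans (.toAddEdge G.addVertex none (some v)))
      D ((D.addVertex (x, c) hx).addEdge (a := none) (b := some v) (γ.addVertex hx)) c {v} where
  toExtends := (extends_addVertex hx).trans (extends_addEdge (a := none) (b := some v) _)
  isUpward := (hD.addVertex hx).addEdge _
  subset_sources := singleton_subset_iff.2 hv
  snd_pos_of_mem_newVerts := by
    rintro (_ | w) hw
    · rfl
    · exact absurd ⟨w, rfl⟩ hw
  existsUnique_src_eq := by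
    rintro (_ | w) hw
    · refine ⟨none, rfl, ?_⟩
      rintro (_ | e) he
      · rfl
      · exact absurd he (Option.some_ne_none _)
    · exact absurd ⟨w, rfl⟩ hw
  bijOn_tgt := by
    have newEdges_eq : ((Embedding.toAddVertex G).trans
        (.toAddEdge G.addVertex none (some v))).newEdges = {none} := compl_range_some E
    rw [newEdges_eq, image_singleton]
    exact bijOn_singleton.2 rfl
  src_mem_newVerts_or_between := by
    rintro (_ | e) he
    · exact .inl fun ⟨w, hw⟩ => Option.some_ne_none w hw
    · exact absurd ⟨e, rfl⟩ he

theorem existsUnique_src_eq_onVert (h : IsSourceCompletion φ D D' c S) {x : V}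
    (hx : ∃! e, G.src e = x) : ∃! f, H.src f = φ.onVert x := by
  obtain ⟨e, rfl, hunique⟩ := hx
  refine ⟨φ.onEdge e, φ.src_onEdge e, fun f hf => ?_⟩
  obtain ⟨e', he', rfl⟩ := (h.outEdges_onVert fun a ha b hb =>
    (hunique a ha).trans (hunique b hb).symm).subset hf
  exact congrArg φ.onEdge (hunique e' he')

theorem bijOn_tgt_trans (hφ : IsSourceCompletion φ D D' c S)
    (hψ : IsSourceCompletion ψ D' D'' c (φ.onVert '' T)) :
    BijOn K.tgt (φ.trans ψ).newEdges ((φ.trans ψ).onVert '' (S ∪ T)) := by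
  have image_eq : ∀ R : Set V, (φ.trans ψ).onVert '' R = ψ.onVert '' (φ.onVert '' R) := fun R =>
    image_comp ψ.onVert φ.onVert R
  have bijOn_old : BijOn K.tgt (ψ.onEdge '' φ.newEdges) (ψ.onVert '' (φ.onVert '' S)) := by
    rw [← hφ.bijOn_tgt.image_eq, image_image, image_congr' fun f => (ψ.tgt_onEdge f).symm,
      ← image_image K.tgt]
    refine InjOn.bijOn_image ?_
    rintro _ ⟨f, hf, rfl⟩ _ ⟨f', hf', rfl⟩ heq
    rw [ψ.tgt_onEdge, ψ.tgt_onEdge] at heq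
    exact congrArg _ (hφ.bijOn_tgt.injOn hf hf' (ψ.onVert.injective heq))
  have disjoint : Disjoint (ψ.onVert '' (φ.onVert '' T)) (ψ.onVert '' (φ.onVert '' S)) := by
    rw [disjoint_image_iff ψ.onVert.injective, disjoint_image_iff φ.onVert.injective,
      disjoint_left]
    exact fun x hxT hxS => (hφ.onVert_mem_sources_iff.1
      (hψ.subset_sources (mem_image_of_mem _ hxT))).2 hxS
  rw [Embedding.newEdges_trans, union_comm S, image_union, image_eq, image_eq]
  have tgt_ne_tgt : ∀ f ∈ ψ.newEdges, ∀ f' ∈ ψ.onEdge '' φ.newEdges, K.tgt f ≠ K.tgt f' :=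
    fun f hf f' hf' => disjoint.ne_of_mem (hψ.bijOn_tgt.mapsTo hf) (bijOn_old.mapsTo hf')
  have disjoint_edges : Disjoint ψ.newEdges (ψ.onEdge '' φ.newEdges) :=
    disjoint_left.2 fun f hf hf' => tgt_ne_tgt f hf f hf' rfl
  exact hψ.bijOn_tgt.union bijOn_old
    ((injOn_union disjoint_edges).2 ⟨hψ.bijOn_tgt.injOn, bijOn_old.injOn, tgt_ne_tgt⟩)

theorem between_trans (hφ : IsSourceCompletion φ D D' c S)
    (hψ : IsSourceCompletion ψ D' D'' c (φ.onVert '' T)) {f : Y} (hf : f ∈ ψ.newEdges) {m M : F}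
    (hm : D''.outLt (K.src f) (ψ.onEdge m) f) (hM : D''.outLt (K.src f) f (ψ.onEdge M)) :
    ∃ m' M', D''.outLt (K.src f) ((φ.trans ψ).onEdge m') f ∧
      D''.outLt (K.src f) f ((φ.trans ψ).onEdge M') := by
  have src_m : ψ.onVert (H.src m) = K.src f := (ψ.src_onEdge m).symm.trans hm.1
  have src_M : ψ.onVert (H.src M) = K.src f := (ψ.src_onEdge M).symm.trans hM.2.1
  obtain ⟨x, hx⟩ : H.src m ∈ range φ.onVert := not_notMem.1 fun hnew =>
    hψ.src_ne_onVert (hφ.outEdges_subsingleton_of_mem_newVerts hnew) hf src_m.symm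
  obtain ⟨m', -, hm', -⟩ := hφ.exists_onEdge_between hx.symm
  obtain ⟨-, M', -, hM'⟩ := hφ.exists_onEdge_between
    (hx.trans (ψ.onVert.injective (src_m.trans src_M.symm))).symm
  rw [← src_m, ← hx] at hm hM ⊢
  have := hψ.isUpward.isStrictOrder_outLt (ψ.onVert (φ.onVert x))
  refine ⟨m', M', ?_, ?_⟩
  · obtain rfl | hlt := hm'
    exacts [hm, _root_.trans (hψ.outLt hlt) hm]
  · obtain rfl | hlt := hM'
    exacts [hM, _root_.trans hM (hψ.outLt hlt)]

protected theorem trans (hφ : IsSourceCompletion φ D D' c S)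
    (hψ : IsSourceCompletion ψ D' D'' c (φ.onVert '' T)) :
    IsSourceCompletion (φ.trans ψ) D D'' c (S ∪ T) where
  toExtends := hφ.toExtends.trans hψ.toExtends
  isUpward := hψ.isUpward
  subset_sources := union_subset hφ.subset_sources fun _ hx =>
    (hφ.onVert_mem_sources_iff.1 (hψ.subset_sources (mem_image_of_mem _ hx))).1
  snd_pos_of_mem_newVerts := by
    rw [Embedding.newVerts_trans]
    rintro _ (hx | ⟨w, hw, rfl⟩)
    · exact hψ.snd_pos_of_mem_newVerts _ hx
    · rw [hψ.pos_onVert, hφ.snd_pos_of_mem_newVerts w hw]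
  existsUnique_src_eq := by
    rw [Embedding.newVerts_trans]
    rintro _ (hx | ⟨w, hw, rfl⟩)
    · exact hψ.existsUnique_src_eq _ hx
    · exact hψ.existsUnique_src_eq_onVert (hφ.existsUnique_src_eq w hw)
  bijOn_tgt := hφ.bijOn_tgt_trans hψ
  src_mem_newVerts_or_between := by
    rw [Embedding.newEdges_trans, Embedding.newVerts_trans]
    rintro _ (hf | ⟨f, hf, rfl⟩)
    · obtain hnew | ⟨m, M, hm, hM⟩ := hψ.src_mem_newVerts_or_between _ hf
      exacts [.inl (.inl hnew), .inr (hφ.between_trans hψ hf hm hM)]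
    · rw [ψ.src_onEdge]
      obtain hnew | ⟨m, M, hm, hM⟩ := hφ.src_mem_newVerts_or_between f hf
      exacts [.inl (.inr ⟨_, hnew, rfl⟩), .inr ⟨m, M, hψ.outLt hm, hψ.outLt hM⟩]

end IsSourceCompletion

theorem exists_isSourceCompletion_singleton {V : Type u} {E : Type v} [Finite V] [Finite E]
    {G : DirGraph V E} {D : G.PlanarEmbedding} (hD : D.IsUpward) {x : V} (hx : x ∈ G.sources)
    (hc : c < (D.pos x).2) :
    ∃ (W : Type u) (F : Type v) (_ : Finite W) (_ : Finite F) (H : DirGraph W F)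
      (φ : G.Embedding H) (D' : H.PlanarEmbedding), IsSourceCompletion φ D D' c {x} := by
  obtain ⟨y, hy, ⟨γ⟩⟩ | ⟨w, γ, a, b, hγ⟩ :=
    hD.exists_freePath_or_leavesBetween (isFreeBelow_pos_of_mem_sources hx) hc
  · exact ⟨_, _, inferInstance, inferInstance, _, _, _, .addVertex_addEdge hD hx hy γ⟩
  · exact ⟨_, _, inferInstance, inferInstance, _, _, _, .addEdge hD hx hγ⟩

theorem exists_isSourceCompletion {V : Type u} {E : Type v} [Finite V] [Finite E]
    {G : DirGraph V E} {D : G.PlanarEmbedding} (hD : D.IsUpward) {S : Set V}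
    (hS : S ⊆ G.sources) (hc : ∀ x ∈ S, c < (D.pos x).2) :
    ∃ (W : Type u) (F : Type v) (_ : Finite W) (_ : Finite F) (H : DirGraph W F)
      (φ : G.Embedding H) (D' : H.PlanarEmbedding), IsSourceCompletion φ D D' c S := by
  induction S, toFinite S using Set.Finite.induction_on with
  | empty => exact ⟨V, E, ‹_›, ‹_›, G, _, D, .refl hD⟩
  | @insert x S hx _ ih =>
    obtain ⟨W, F, _, _, H, φ, D', hφ⟩ :=
      ih ((subset_insert x S).trans hS) fun y hy => hc y (mem_insert_of_mem x hy)
    obtain ⟨X, Y, _, _, K, ψ, D'', hψ⟩ := exists_isSourceCompletion_singleton (c := c) hφ.isUpward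
      (hφ.onVert_mem_sources_iff.2 ⟨hS (mem_insert x S), hx⟩)
      (by rw [hφ.pos_onVert]; exact hc x (mem_insert x S))
    rw [← image_singleton] at hψ
    exact ⟨X, Y, ‹_›, ‹_›, K, _, D'', insert_eq x S ▸ union_comm S {x} ▸ hφ.trans hψ⟩

/-- The upward drawing `D'` arises from `D` by drawing one new edge from each sink in `T`, with new
vertices at height `d`. This is the mirror image of a source completion. -/
def IsSinkCompletion (φ : G.Embedding H) (D : G.PlanarEmbedding) (D' : H.PlanarEmbedding)
    (d : ℝ) (T : Set V) : Prop :=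
  IsSourceCompletion φ.reverse D.reflect D'.reflect (-d) T

theorem exists_isSinkCompletion {V : Type u} {E : Type v} [Finite V] [Finite E]
    {G : DirGraph V E} {D : G.PlanarEmbedding} (hD : D.IsUpward) {T : Set V} (hT : T ⊆ G.sinks)
    (hd : ∀ x ∈ T, (D.pos x).2 < d) :
    ∃ (W : Type u) (F : Type v) (_ : Finite W) (_ : Finite F) (H : DirGraph W F)
      (φ : G.Embedding H) (D' : H.PlanarEmbedding), IsSinkCompletion φ D D' d T := by
  obtain ⟨W, F, hW, hF, H, φ, D', h⟩ :=
    exists_isSourceCompletion (c := -d) hD.reflect hT fun x hx => neg_lt_neg (hd x hx)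
  rw [← D'.reflect_reflect] at h
  exact ⟨W, F, hW, hF, H.reverse, φ.reverse, D'.reflect, h⟩

namespace IsSinkCompletion

theorem toExtends (h : IsSinkCompletion φ D D' d T) : φ.Extends D D' := by
  have := (IsSourceCompletion.toExtends h).reflect
  rwa [D.reflect_reflect, D'.reflect_reflect] at this

theorem isUpward (h : IsSinkCompletion φ D D' d T) : D'.IsUpward :=
  D'.reflect_reflect ▸ (IsSourceCompletion.isUpward h).reflect

theorem snd_pos_of_mem_newVerts (h : IsSinkCompletion φ D D' d T) {w : W} (hw : w ∈ φ.newVerts) :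
    (D'.pos w).2 = d :=
  neg_inj.1 (IsSourceCompletion.snd_pos_of_mem_newVerts h w hw)

theorem tgt_mem_newVerts_or_between (h : IsSinkCompletion φ D D' d T) {f : F}
    (hf : f ∈ φ.newEdges) : H.tgt f ∈ φ.newVerts ∨
      ∃ m M, D'.inLt (H.tgt f) m f ∧ D'.inLt (H.tgt f) f M := by
  rw [← D'.outLt_reflect]
  exact (IsSourceCompletion.src_mem_newVerts_or_between h f hf).imp_right
    fun ⟨_, _, hbetween⟩ => ⟨_, _, hbetween⟩

theorem tgt_ne_onVert (h : IsSinkCompletion φ D D' d T) {x : V}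
    (hx : (G.inEdges x).Subsingleton) {f : F} (hf : f ∈ φ.newEdges) : H.tgt f ≠ φ.onVert x :=
  IsSourceCompletion.src_ne_onVert h hx hf

theorem sources_eq (h : IsSinkCompletion φ D D' d T) : H.sources = φ.onVert '' G.sources :=
  IsSourceCompletion.sinks_eq h

theorem sinks_eq (h : IsSinkCompletion φ D D' d G.sinks) : H.sinks = φ.newVerts :=
  IsSourceCompletion.sources_eq h

theorem degree_of_mem_newVerts (h : IsSinkCompletion φ D D' d T) {w : W} (hw : w ∈ φ.newVerts) :
    H.degree w = 1 := by
  rw [← degree_reverse]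
  exact IsSourceCompletion.degree_of_mem_newVerts h hw

theorem degree_onVert (h : IsSinkCompletion φ D D' d T) {x : V} (hx : x ∉ T)
    (hin : (G.inEdges x).Subsingleton) : H.degree (φ.onVert x) = G.degree x := by
  rw [← H.degree_reverse, ← G.degree_reverse]
  exact IsSourceCompletion.degree_onVert h hx hin

theorem card_edges [Finite F] (h : IsSinkCompletion φ D D' d T) :
    Nat.card F = Nat.card E + T.ncard :=
  IsSourceCompletion.card_edges h

end IsSinkCompletion

namespace PlanarEmbedding

theorem exists_forall_norm_lt [Finite V] [Finite E] (D : G.PlanarEmbedding) :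
    ∃ r > 0, (∀ x, ‖D.pos x‖ < r) ∧ ∀ e t, ‖D.curve e t‖ < r := by
  have isBounded : Bornology.IsBounded (range D.pos ∪ ⋃ e, range (D.curve e)) :=
    (finite_range D.pos).isBounded.union <| Bornology.isBounded_iUnion.2 fun e =>
      (isCompact_range (D.continuous_curve e)).isBounded
  obtain ⟨r, hr, hsub⟩ := isBounded.subset_ball_lt 0 0
  refine ⟨r, hr, fun x => ?_, fun e t => ?_⟩
  · exact mem_ball_zero_iff.1 (hsub (.inl ⟨x, rfl⟩))
  · exact mem_ball_zero_iff.1 (hsub (.inr (mem_iUnion.2 ⟨e, t, rfl⟩)))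

theorem IsUpward.isBoxed [Finite V] [Finite E] (hD : D.IsUpward) (hcd : c < d)
    (hheight : ∀ x, (D.pos x).2 ∈ Icc c d) (hsources : ∀ x ∈ G.sources, (D.pos x).2 = c)
    (hsinks : ∀ x ∈ G.sinks, (D.pos x).2 = d) : D.IsBoxed := by
  obtain ⟨r, hr, hpos, hcurve⟩ := D.exists_forall_norm_lt
  have fst_mem : ∀ p : ℝ × ℝ, ‖p‖ < r → p.1 ∈ Icc (-r) r := fun p hp =>
    abs_le.1 ((norm_fst_le p).trans hp.le)
  refine ⟨-r, r, c, d, neg_lt_self hr, hcd, fun x => ⟨fst_mem _ (hpos x), hheight x⟩,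
    fun e t => ⟨fst_mem _ (hcurve e t), ?_⟩, hsources, hsinks⟩
  exact Icc_subset_Icc (hheight (G.src e)).1 (hheight (G.tgt e)).2 (hD.snd_curve_mem_Icc e t)

end PlanarEmbedding

namespace IsSourceCompletion

theorem sources_eq_image_newVerts (hφ : IsSourceCompletion φ D D' c G.sources)
    (hψ : IsSinkCompletion ψ D' D'' d H.sinks) : K.sources = ψ.onVert '' φ.newVerts := by
  rw [hψ.sources_eq, hφ.sources_eq]

theorem range_onVert_trans (hφ : IsSourceCompletion φ D D' c G.sources)
    (hψ : IsSinkCompletion ψ D' D'' d H.sinks) :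
    range (φ.trans ψ).onVert = univ \ (K.sources ∪ K.sinks) := by
  rw [hφ.sources_eq_image_newVerts hψ, hψ.sinks_eq, union_comm, ← Embedding.newVerts_trans,
    ← compl_eq_univ_sdiff, Embedding.newVerts, compl_compl]

theorem isProgressive (hφ : IsSourceCompletion φ D D' c G.sources)
    (hψ : IsSinkCompletion ψ D' D'' d H.sinks) : K.IsProgressive where
  acyclic := hψ.isUpward.acyclic
  degree_source := by
    rw [hφ.sources_eq_image_newVerts hψ]
    rintro _ ⟨w, hw, rfl⟩
    have hin : H.inEdges w = ∅ := hφ.newVerts_subset_sources hw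
    have hsink : w ∉ H.sinks := fun hsink => hw (image_subset_range _ _ (hφ.sinks_eq.subset hsink))
    rw [hψ.degree_onVert hsink (by simp [hin]), hφ.degree_of_mem_newVerts hw]
  degree_sink x hx := hψ.degree_of_mem_newVerts (hψ.sinks_eq.subset hx)

theorem isBoxed [Finite X] [Finite Y] (hφ : IsSourceCompletion φ D D' c G.sources)
    (hψ : IsSinkCompletion ψ D' D'' d H.sinks) (hcd : c < d)
    (hD : ∀ x, (D.pos x).2 ∈ Icc c d) : D''.IsBoxed := by
  have height_new : ∀ w ∈ φ.newVerts, (D''.pos (ψ.onVert w)).2 = c := fun w hw => by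
    rw [hψ.toExtends.pos_onVert, hφ.snd_pos_of_mem_newVerts w hw]
  refine hψ.isUpward.isBoxed hcd (fun x => ?_) ?_ fun x hx =>
    hψ.snd_pos_of_mem_newVerts (hψ.sinks_eq.subset hx)
  · by_cases hx : x ∈ ψ.newVerts
    · rw [hψ.snd_pos_of_mem_newVerts hx]
      exact right_mem_Icc.2 hcd.le
    obtain ⟨w, rfl⟩ := not_notMem.1 hx
    by_cases hw : w ∈ φ.newVerts
    · rw [height_new w hw]
      exact left_mem_Icc.2 hcd.le
    obtain ⟨v, rfl⟩ := not_notMem.1 hw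
    rw [hψ.toExtends.pos_onVert, hφ.pos_onVert]
    exact hD v
  · rwa [hφ.sources_eq_image_newVerts hψ, forall_mem_image]

theorem card_edges_trans [Finite F] [Finite Y] (hφ : IsSourceCompletion φ D D' c G.sources)
    (hψ : IsSinkCompletion ψ D' D'' d H.sinks) :
    Nat.card Y = Nat.card E + G.sources.ncard + G.sinks.ncard := by
  rw [hψ.card_edges, hφ.card_edges, hφ.sinks_eq, ncard_image_of_injective _ φ.onVert.injective]

theorem inEdges_inter_outEdges_eq_empty (hφ : IsSourceCompletion φ D D' c G.sources)
    (hψ : IsSinkCompletion ψ D' D'' d H.sinks) {x y : V} (hx : x ∈ G.sources)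
    (hy : y ∈ G.sinks) :
    K.inEdges ((φ.trans ψ).onVert x) ∩ K.outEdges ((φ.trans ψ).onVert y) = ∅ := by
  refine eq_empty_iff_forall_notMem.2 fun f ⟨htgt, hsrc⟩ => ?_
  by_cases hf : f ∈ ψ.newEdges
  · exact hψ.tgt_ne_onVert (hφ.inEdges_onVert_subsingleton hx) hf htgt
  · obtain ⟨g, rfl⟩ := not_notMem.1 hf
    have hsink : φ.onVert y ∈ H.sinks := hφ.sinks_eq ▸ mem_image_of_mem _ hy
    exact mem_sinks.1 hsink g (ψ.onVert.injective ((ψ.src_onEdge g).symm.trans hsrc))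

theorem strictlyInside [Finite Y] (hφ : IsSourceCompletion φ D D' c G.sources)
    (hψ : IsSinkCompletion ψ D' D'' d H.sinks) {f : Y}
    (hf : f ∉ range (φ.trans ψ).onEdge ∪ K.inputEdges ∪ K.outputEdges) :
    StrictlyInside (D''.outLt (K.src f)) (K.outEdges (K.src f)) f ∨
      StrictlyInside (D''.inLt (K.tgt f)) (K.inEdges (K.tgt f)) f := by
  simp only [mem_union, not_or] at hf
  obtain ⟨⟨hnew, hinput⟩, houtput⟩ := hf
  obtain hf | ⟨g, hg, rfl⟩ : f ∈ ψ.newEdges ∪ ψ.onEdge '' φ.newEdges :=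
    Embedding.newEdges_trans φ ψ ▸ hnew
  · obtain htgt | ⟨m, M, hm, hM⟩ := hψ.tgt_mem_newVerts_or_between hf
    · exact absurd (hψ.sinks_eq.superset htgt) houtput
    · exact .inr (hψ.isUpward.strictlyInside_inLt hm hM)
  · obtain hsrc | ⟨m, M, hm, hM⟩ := hφ.src_mem_newVerts_or_between g hg
    · refine absurd ?_ hinput
      rw [inputEdges, mem_ofPred_eq, hφ.sources_eq_image_newVerts hψ, ψ.src_onEdge]
      exact mem_image_of_mem _ hsrc
    · rw [ψ.src_onEdge]
      exact .inl (hψ.isUpward.strictlyInside_outLt (hψ.toExtends.outLt hm) (hψ.toExtends.outLt hM))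

end IsSourceCompletion

end DirGraph

theorem mainTheorem6 {V : Type u} {E : Type v} [Finite V] [Finite E]
    (G : UpwardPlanarGraph V E) :
    ∃ (W : Type u) (F : Type v) (_ : Finite W) (_ : Finite F)
      (Γ : ProgressivePlaneGraph W F) (φ : G.graph.Embedding Γ.graph),
      -- the drawing of `G` is part of the drawing of `Γ`
      (∀ x, Γ.drawing.pos (φ.onVert x) = G.drawing.pos x) ∧
      (∀ e, Γ.drawing.curve (φ.onEdge e) = G.drawing.curve e) ∧
      -- (1)
      Set.range φ.onVert = Set.univ \ (Γ.graph.sources ∪ Γ.graph.sinks) ∧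
      -- (2)
      Nat.card F = Nat.card E + G.graph.sources.ncard + G.graph.sinks.ncard ∧
      -- (3)
      (∀ x ∈ G.graph.sources, ∀ y ∈ G.graph.sinks,
        Γ.graph.inEdges (φ.onVert x) ∩ Γ.graph.outEdges (φ.onVert y) = ∅) ∧
      -- (4)
      (∀ e, e ∉ Set.range φ.onEdge ∪ Γ.graph.inputEdges ∪ Γ.graph.outputEdges →
        StrictlyInside (Γ.drawing.outLt (Γ.graph.src e))
            (Γ.graph.outEdges (Γ.graph.src e)) e ∨
          StrictlyInside (Γ.drawing.inLt (Γ.graph.tgt e))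
            (Γ.graph.inEdges (Γ.graph.tgt e)) e) := by
  obtain ⟨r, hr, hpos, -⟩ := G.drawing.exists_forall_norm_lt
  have height_mem : ∀ x, (G.drawing.pos x).2 ∈ Ioo (-r) r := fun x =>
    abs_lt.1 ((norm_snd_le _).trans_lt (hpos x))
  obtain ⟨W, F, _, _, H, φ, D, hφ⟩ :=
    DirGraph.exists_isSourceCompletion G.upward Subset.rfl fun x _ => (height_mem x).1
  have sinks_lt : ∀ w ∈ H.sinks, (D.pos w).2 < r := by
    rw [hφ.sinks_eq, forall_mem_image]
    intro x _
    rw [hφ.pos_onVert]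
    exact (height_mem x).2
  obtain ⟨X, Y, _, _, K, ψ, D', hψ⟩ :=
    DirGraph.exists_isSinkCompletion hφ.isUpward Subset.rfl sinks_lt
  have isBoxed : D'.IsBoxed :=
    hφ.isBoxed hψ (neg_lt_self hr) fun x => Ioo_subset_Icc_self (height_mem x)
  have hext : (φ.trans ψ).Extends G.drawing D' := hφ.toExtends.trans hψ.toExtends
  exact ⟨X, Y, ‹_›, ‹_›, ⟨K, hφ.isProgressive hψ, D', hψ.isUpward, isBoxed⟩, φ.trans ψ,
    hext.pos_onVert, hext.curve_onEdge, hφ.range_onVert_trans hψ, hφ.card_edges_trans hψ,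
    fun _ hx _ hy => hφ.inEdges_inter_outEdges_eq_empty hψ hx hy,
    fun _ hf => hφ.strictlyInside hψ hf⟩
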